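/- Let $\lambda$ be an ordinal and let $\mathcal{E}_\lambda$ be the set of all elementary embeddings $j:(V_\lambda,\in)\to(V_\lambda,\in)$. Let $\mathrm{crit}(j)$ be the least ordinal moved by $j$ (if there is one). Let $(\kappa_n)_{n\in\omega}$ be a (not necessarily strictly) increasing sequence, cofinal in $\lambda$, such that each $\kappa_n$ is the critical point of some $j_n\in\mathcal{E}_\lambda$. For $j,k\in\mathcal{E}_\lambda$ put $j*k=\bigcup_{\alpha<\lambda}j(k|_{V_\alpha})$, let $j\circ k$ be the composition, and let $j\equiv^{\gamma}k$ mean that $j(x)\cap V_\gamma=k(x)\cap V_\gamma$ for all $x\in V_\gamma$. Give $\mathcal{E}_\lambda$ the topology in which $U$ is open iff for each $j\in U$ there is $\gamma<\lambda$ such that every $k\in\mathcal{E}_\lambda$ with $k|_{V_\gamma}=j|_{V_\gamma}$ lies in $U$. Definitions. An LD-system is a set $X$ with an operation satisfying $x*(y*z)=(x*y)*(x*z)$. An LD-monoid is an algebra $(X,*,\circ,1)$ such that $(X,\circ,1)$ is a monoid and $(x\circ y)*z=x*(y*z)$, $x*(y\circ z)=(x*y)\circ(x*z)$, $x\circ y=(x*y)\circ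 x$, $1*x=x$, $x*1=1$. For an LD-system $X$ let $\mathrm{Li}(X)=\{x: x*y=y\text{ for all }y\}$. $X$ is permutative if $x*y\in\mathrm{Li}(X)$ whenever $y\in\mathrm{Li}(X)$, and for all $x,y$ some $t_n(x,y)$ is in $\mathrm{Li}(X)$, where $t_1(x,y)=y$, $t_2(x,y)=x$, $t_{n+2}(x,y)=t_{n+1}(x,y)*t_n(x,y)$. For $X$ permutative, write $\mathrm{crit}(x)\le\mathrm{crit}(y)$ if $x*(x*\cdots(x*y))\in\mathrm{Li}(X)$ for some number of factors $x$ (possibly none); this is a preorder on $X$, $\mathrm{crit}(x)$ is the class of $x$ under the associated equivalence, and $\mathrm{crit}[X]$ is the ordered set of these classes. Put $x^\sharp(\mathrm{crit}(r))=\mathrm{crit}(x*r)$. For $\alpha\in\mathrm{crit}[X]$ let $x\equiv^\alpha y$ iff $r*x=r*y$, where $r$ is such that $\mathrm{crit}(r)=\alpha$ and $r*r\in\mathrm{Li}(X)$. An inverse system $\mathcal{X}=(X_n)_{n\in\omega}$ of permutative LD-systems with transitional homomorphisms $\phi_n:X_{n+1}\to X_n$ is vast if (1) for each $n$ the kernel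 of $\phi_n$ is $\equiv^{\alpha}$ for some $\alpha\in\mathrm{crit}[X_{n+1}]$, and (2) for all $x,y\in X_n$ there are $m\ge n$ and $x',y'\in X_m$ that are mapped to $x,y$ by the transitional map $X_m\to X_n$ and satisfy $x'*y'\notin\mathrm{Li}(X_m)$. In this case $\mathrm{crit}[X_n]$ is regarded as an initial segment of $\mathrm{crit}[X_{n+1}]$ by identifying $\alpha\in\mathrm{crit}[X_n]$ with the least element of $\{\mathrm{crit}(x): x\in X_{n+1},\ \mathrm{crit}(\phi_n(x))=\alpha\}$ (so that $\mathrm{crit}(\phi_n(x))=\mathrm{crit}(x)$ if $\phi_n(x)\notin\mathrm{Li}(X_n)$), and $\mathrm{crit}[\mathcal{X}]=\bigcup_n\mathrm{crit}[X_n]$. Then $\mathrm{EE}(\mathcal{X})\subseteq\varprojlim X_n$ is the set of all threads $(x_n)_n$ such that for each $\alpha\in\mathrm{crit}[\mathcal{X}]$ there is an $m$ with $\alpha\in\mathrm{crit}[X_m]$ and $x_m^\sharp(\alpha)<\max(\mathrm{crit}[X_m])$. It carries the subspace topology of the inverse limit of the discrete spaces $X_n$. Theorem. $(\mathcal{E}_\lambda,*,\circ,1_{V_\lambda})$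 is an LD-monoid (in particular $j*k\in\mathcal{E}_\lambda$ for all $j,k\in\mathcal{E}_\lambda$), each $\equiv^{\kappa_n}$ is a congruence on it, and the quotients $\mathcal{E}_\lambda/{\equiv^{\kappa_n}}$ with the maps $[j]_{\kappa_{n+1}}\mapsto[j]_{\kappa_n}$ form a vast inverse system of permutative LD-systems. The set $\mathrm{EE}((\mathcal{E}_\lambda/{\equiv^{\kappa_n}})_{n\in\omega})$ is an LD-monoid under the componentwise operations, and $$\Gamma:\mathcal{E}_\lambda\to\mathrm{EE}((\mathcal{E}_\lambda/{\equiv^{\kappa_n}})_{n\in\omega}),\qquad \Gamma(j)=([j]_{\kappa_n})_{n\in\omega},$$ is well defined, a homeomorphism, and an isomorphism of LD-monoids. -/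

import Mathlib

universe u v

open scoped Quandles ZFSet FirstOrder

namespace RankIntoRank

/-! ### LD-systems, LD-monoids and permutative LD-systems

An LD-system is a `Shelf`; its operation is written `x ◃ y`. -/

/-- An LD-monoid `(X, ◃, *, 1)`; the composition `∘` is written multiplicatively. -/
class LDMonoid (X : Type v) extends Monoid X, Shelf X where
  mul_act : ∀ x y z : X, (x * y) ◃ z = x ◃ (y ◃ z)
  act_mul : ∀ x y z : X, x ◃ (y * z) = (x ◃ y) * (x ◃ z)
  mul_eq_act_mul : ∀ x y : X, x * y = (x ◃ y) * x
  one_act : ∀ x : X, (1 : X) ◃ x = x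
  act_one : ∀ x : X, x ◃ (1 : X) = 1

/-- A congruence of an LD-monoid: an equivalence relation compatible with both operations. -/
structure IsLDCongruence {X : Type v} [LDMonoid X] (r : Setoid X) : Prop where
  act : ∀ {x x' y y' : X}, r x x' → r y y' → r (x ◃ y) (x' ◃ y')
  mul : ∀ {x x' y y' : X}, r x x' → r y y' → r (x * y) (x' * y')

/-- The quotient of an LD-monoid by a congruence. -/
def LDQuot {X : Type v} [LDMonoid X] (r : Setoid X) (_h : IsLDCongruence r) : Type v :=
  Quotient r

/-- The class of an element in the quotient of an LD-monoid by a congruence. -/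
def LDQuot.mk {X : Type v} [LDMonoid X] {r : Setoid X} (h : IsLDCongruence r) (x : X) :
    LDQuot r h :=
  Quotient.mk r x

instance {X : Type v} [LDMonoid X] (r : Setoid X) (h : IsLDCongruence r) :
    LDMonoid (LDQuot r h) where
  act := Quotient.map₂ (fun x y => x ◃ y) fun _ _ hx _ _ hy => h.act hx hy
  mul := Quotient.map₂ (fun x y => x * y) fun _ _ hx _ _ hy => h.mul hx hy
  one := LDQuot.mk h 1
  self_distrib := by
    rintro ⟨x⟩ ⟨y⟩ ⟨z⟩
    exact congrArg (Quotient.mk r) (Shelf.self_distrib (x := x) (y := y) (z := z))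
  mul_assoc := by
    rintro ⟨x⟩ ⟨y⟩ ⟨z⟩
    exact congrArg (Quotient.mk r) (mul_assoc x y z)
  one_mul := by
    rintro ⟨x⟩
    exact congrArg (Quotient.mk r) (one_mul x)
  mul_one := by
    rintro ⟨x⟩
    exact congrArg (Quotient.mk r) (mul_one x)
  mul_act := by
    rintro ⟨x⟩ ⟨y⟩ ⟨z⟩
    exact congrArg (Quotient.mk r) (LDMonoid.mul_act x y z)
  act_mul := by
    rintro ⟨x⟩ ⟨y⟩ ⟨z⟩
    exact congrArg (Quotient.mk r) (LDMonoid.act_mul x y z)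
  mul_eq_act_mul := by
    rintro ⟨x⟩ ⟨y⟩
    exact congrArg (Quotient.mk r) (LDMonoid.mul_eq_act_mul x y)
  one_act := by
    rintro ⟨x⟩
    exact congrArg (Quotient.mk r) (LDMonoid.one_act x)
  act_one := by
    rintro ⟨x⟩
    exact congrArg (Quotient.mk r) (LDMonoid.act_one x)

/-- The set of left identities of an LD-system. -/
def Li (X : Type v) [Shelf X] : Set X := {x | ∀ y : X, x ◃ y = y}

/-- The Fibonacci terms, numbered from `0`: `fib x y n` is `t_{n+1}(x, y)`, where
`t_1(x, y) = y`, `t_2(x, y) = x` and `t_{n+2} = t_{n+1} ◃ t_n`. -/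
def fib {X : Type v} [Shelf X] (x y : X) : ℕ → X
  | 0 => y
  | 1 => x
  | n + 2 => fib x y (n + 1) ◃ fib x y n

/-- Permutative LD-systems: the left identities form a left ideal and every sequence of Fibonacci
terms reaches a left identity. -/
class IsPermutative (X : Type v) [Shelf X] : Prop where
  leftIdeal : ∀ x y : X, y ∈ Li X → x ◃ y ∈ Li X
  exists_fib_mem : ∀ x y : X, ∃ n, fib x y n ∈ Li X

/-! ### Critical points in permutative LD-systems -/

/-- `crit x ≤ crit y`: some `x ◃ (x ◃ ⋯ (x ◃ y))` is a left identity. -/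
def CritLE {X : Type v} [Shelf X] (x y : X) : Prop :=
  ∃ n : ℕ, (fun z => x ◃ z)^[n] y ∈ Li X

theorem iterate_act {X : Type v} [Shelf X] (r x y : X) (n : ℕ) :
    (fun z => (r ◃ x) ◃ z)^[n] (r ◃ y) = r ◃ (fun z => x ◃ z)^[n] y := by
  induction n with
  | zero => rfl
  | succ n ih =>
    rw [Function.iterate_succ_apply', Function.iterate_succ_apply', ih]
    exact Shelf.self_distrib.symm

theorem fib_self_act {X : Type v} [Shelf X] (x : X) (n : ℕ) :
    ∃ N : ℕ, ∀ m ≥ N, fib x x n ◃ (fun z => x ◃ z)^[m] x = (fun z => x ◃ z)^[m + 1] x := by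
  induction n using Nat.twoStepInduction with
  | zero => exact ⟨0, fun m _ => by rw [Function.iterate_succ_apply']; rfl⟩
  | one => exact ⟨0, fun m _ => by rw [Function.iterate_succ_apply']; rfl⟩
  | more n ih₁ ih₂ =>
    obtain ⟨N₁, h₁⟩ := ih₁
    obtain ⟨N₂, h₂⟩ := ih₂
    refine ⟨max N₁ N₂ + 1, fun m hm => ?_⟩
    obtain ⟨m, rfl⟩ : ∃ m', m = m' + 1 := ⟨m - 1, by omega⟩
    have hm₁ : m ≥ N₁ := by have := le_max_left N₁ N₂; omega
    have hm₂ : m ≥ N₂ := by have := le_max_right N₁ N₂; omega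
    change (fib x x (n + 1) ◃ fib x x n) ◃ _ = _
    rw [← h₂ m hm₂, ← Shelf.self_distrib, h₁ m hm₁, h₂ (m + 1) (by omega)]

theorem fib_self_iterate {X : Type v} [Shelf X] (x : X) (n : ℕ) :
    ∃ N c : ℕ, ∀ m ≥ N,
      (fun z => fib x x n ◃ z)^[m] (fib x x n) = (fun z => x ◃ z)^[m + c] x := by
  induction n using Nat.twoStepInduction with
  | zero => exact ⟨0, 0, fun m _ => rfl⟩
  | one => exact ⟨0, 0, fun m _ => rfl⟩
  | more n ih₁ _ =>
    obtain ⟨N₁, c, h₁⟩ := ih₁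
    obtain ⟨N₂, h₂⟩ := fib_self_act x (n + 1)
    refine ⟨max N₁ N₂, c + 1, fun m hm => ?_⟩
    have hm₁ : m ≥ N₁ := le_trans (le_max_left _ _) hm
    have hm₂ : m ≥ N₂ := le_trans (le_max_right _ _) hm
    change (fun z => (fib x x (n + 1) ◃ fib x x n) ◃ z)^[m] (fib x x (n + 1) ◃ fib x x n) = _
    rw [iterate_act, h₁ m hm₁, h₂ (m + c) (by omega)]
    rfl

theorem iterate_mem {X : Type v} [Shelf X] [IsPermutative X] (x y : X) (hy : y ∈ Li X) (n : ℕ) :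
    (fun z => x ◃ z)^[n] y ∈ Li X := by
  induction n with
  | zero => exact hy
  | succ n ih =>
    rw [Function.iterate_succ_apply']
    exact IsPermutative.leftIdeal _ _ ih

theorem critLE_refl {X : Type v} [Shelf X] [IsPermutative X] (x : X) : CritLE x x := by
  obtain ⟨n, hn⟩ := IsPermutative.exists_fib_mem x x
  obtain ⟨N, c, h⟩ := fib_self_iterate x n
  exact ⟨N + c, h N le_rfl ▸ iterate_mem _ _ hn N⟩

theorem critLE_trans {X : Type v} [Shelf X] [IsPermutative X] {x y z : X} (hxy : CritLE x y)
    (hyz : CritLE y z) : CritLE x z := by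
  obtain ⟨m, hm⟩ := hxy
  obtain ⟨n, hn⟩ := hyz
  have key : ∀ (k l : ℕ), (fun w => (fun w => x ◃ w)^[k] y ◃ w)^[l] ((fun w => x ◃ w)^[k] z) =
      (fun w => x ◃ w)^[k] ((fun w => y ◃ w)^[l] z) := by
    intro k l
    induction k with
    | zero => rfl
    | succ k ih => simp only [Function.iterate_succ_apply']; rw [iterate_act, ih]
  have fixed : ∀ l : ℕ, (fun w => (fun w => x ◃ w)^[m] y ◃ w)^[l] ((fun w => x ◃ w)^[m] z) =
      (fun w => x ◃ w)^[m] z := by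
    intro l
    induction l with
    | zero => rfl
    | succ l ih => rw [Function.iterate_succ_apply', ih]; exact hm _
  exact ⟨m, by rw [← fixed n, key]; exact iterate_mem _ _ hn m⟩

theorem critLE_act {X : Type v} [Shelf X] [IsPermutative X] (r : X) {x y : X}
    (h : CritLE x y) : CritLE (r ◃ x) (r ◃ y) := by
  obtain ⟨n, hn⟩ := h
  exact ⟨n, by rw [iterate_act]; exact IsPermutative.leftIdeal _ _ hn⟩

/-- `crit x = crit y` iff `crit x ≤ crit y` and `crit y ≤ crit x`. -/
def critSetoid (X : Type v) [Shelf X] [IsPermutative X] : Setoid X where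
  r x y := CritLE x y ∧ CritLE y x
  iseqv := ⟨fun x => ⟨critLE_refl x, critLE_refl x⟩, fun h => ⟨h.2, h.1⟩,
    fun h h' => ⟨critLE_trans h.1 h'.1, critLE_trans h'.2 h.2⟩⟩

/-- The set `crit[X]` of critical points of a permutative LD-system. -/
def Crit (X : Type v) [Shelf X] [IsPermutative X] : Type v := Quotient (critSetoid X)

/-- The critical point of an element of a permutative LD-system. -/
def crit {X : Type v} [Shelf X] [IsPermutative X] (x : X) : Crit X := Quotient.mk (critSetoid X) x

instance (X : Type v) [Shelf X] [IsPermutative X] : PartialOrder (Crit X) where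
  le := Quotient.lift₂ CritLE fun _ _ _ _ h h' => propext
    ⟨fun k => critLE_trans h.2 (critLE_trans k h'.1),
      fun k => critLE_trans h.1 (critLE_trans k h'.2)⟩
  le_refl := by
    rintro ⟨x⟩
    exact critLE_refl x
  le_trans := by
    rintro ⟨x⟩ ⟨y⟩ ⟨z⟩ h h'
    exact critLE_trans h h'
  le_antisymm := by
    rintro ⟨x⟩ ⟨y⟩ h h'
    exact Quotient.sound ⟨h, h'⟩

/-- The map `x^♯ : crit[X] → crit[X]`, `x^♯ (crit r) = crit (x ◃ r)`. -/
def sharp {X : Type v} [Shelf X] [IsPermutative X] (x : X) : Crit X → Crit X :=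
  Quotient.map (fun r => x ◃ r) fun _ _ h => ⟨critLE_act x h.1, critLE_act x h.2⟩

/-- The congruence `≡^α` on a permutative LD-system, for `α ∈ crit[X]`: `x ≡^α y` iff
`r ◃ x = r ◃ y`, where `crit r = α` and `r ◃ r` is a left identity. -/
def EquivAt {X : Type v} [Shelf X] [IsPermutative X] (α : Crit X) (x y : X) : Prop :=
  ∃ r : X, r ◃ r ∈ Li X ∧ crit r = α ∧ r ◃ x = r ◃ y

/-! ### Inverse systems of permutative LD-systems -/

section InverseSystem

variable {X : ℕ → Type v} [∀ n, Shelf (X n)]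

/-- The transitional map `X (n + k) → X n` of an inverse system. -/
def transition (φ : ∀ n, X (n + 1) →◃ X n) (n : ℕ) : ∀ k : ℕ, X (n + k) → X n
  | 0 => id
  | k + 1 => fun x => transition φ n k ((φ (n + k)).toFun x)

variable [∀ n, IsPermutative (X n)]

/-- Vast inverse systems of permutative LD-systems. -/
structure IsVast (φ : ∀ n, X (n + 1) →◃ X n) : Prop where
  ker_eq : ∀ n, ∃ α : Crit (X (n + 1)),
    ∀ x y : X (n + 1), (φ n).toFun x = (φ n).toFun y ↔ EquivAt α x y
  exists_lift : ∀ n, ∀ x y : X n, ∃ k, ∃ x' y' : X (n + k),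
    transition φ n k x' = x ∧ transition φ n k y' = y ∧ x' ◃ y' ∉ Li (X (n + k))

/-- The identification of `crit[X n]` with an initial segment of `crit[X (n + 1)]`:
`α ∈ crit[X n]` is identified with the least critical point of an `x` with `crit (φ n x) = α`.
Hence `crit (φ n x)` is identified with `crit x` when `φ n x` is not a left identity, and
the greatest element of `crit[X n]` with the least element above all of these. -/
inductive CritIdent (φ : ∀ n, X (n + 1) →◃ X n) :
    (Σ n, Crit (X n)) → (Σ n, Crit (X n)) → Prop
  | step (n : ℕ) (α : Crit (X n)) (β : Crit (X (n + 1)))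
      (h : IsLeast {γ | ∃ x : X (n + 1), crit ((φ n).toFun x) = α ∧ crit x = γ} β) :
      CritIdent φ ⟨n, α⟩ ⟨n + 1, β⟩

/-- The union `⋃ n, crit[X n]`, under the identifications above. -/
def CritUnion (φ : ∀ n, X (n + 1) →◃ X n) : Type v := Quot (CritIdent φ)

/-- The inclusion of `crit[X n]` into the union of all of these. -/
def CritUnion.incl (φ : ∀ n, X (n + 1) →◃ X n) (n : ℕ) (α : Crit (X n)) : CritUnion φ :=
  Quot.mk _ ⟨n, α⟩

/-- The set `EE` of all threads `x` of the inverse system such that for each `α` in the union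
of the sets `crit[X n]` there is an `m` with `α ∈ crit[X m]` and `x_m^♯ α < max crit[X m]`. -/
def EE (φ : ∀ n, X (n + 1) →◃ X n) : Set (∀ n, X n) :=
  {x | (∀ n, (φ n).toFun (x (n + 1)) = x n) ∧
    ∀ α : CritUnion φ, ∃ m, ∃ β : Crit (X m), CritUnion.incl φ m β = α ∧
      ∃ μ : Crit (X m), IsTop μ ∧ sharp (x m) β < μ}

/-- The topology of `EE` as a subspace of the inverse limit of the discrete spaces `X n`. -/
instance (φ : ∀ n, X (n + 1) →◃ X n) : TopologicalSpace (EE φ) :=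
  TopologicalSpace.induced Subtype.val (@Pi.topologicalSpace ℕ X fun _ => ⊥)

end InverseSystem

/-! ### Elementary embeddings of `V_λ` into itself -/

/-- The only symbol of the language of set theory is a binary relation symbol. -/
inductive SetRel : ℕ → Type
  | mem : SetRel 2

/-- The first-order language of set theory. -/
def setLanguage : FirstOrder.Language.{0, 0} := ⟨fun _ => Empty, SetRel⟩

/-- The rank `V_λ` of the cumulative hierarchy, as a type. -/
abbrev VSet (lam : Ordinal.{u}) : Type (u + 1) := {x : ZFSet.{u} // x ∈ V_ lam}

/-- `V_λ` as a structure `(V_λ, ∈)`. -/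
instance (lam : Ordinal.{u}) : setLanguage.Structure (VSet lam) where
  funMap f _ := f.elim
  RelMap r v := match r, v with
    | SetRel.mem, v => (v 0).1 ∈ (v 1).1

/-- The set `E_λ` of all elementary embeddings from `V_λ` to `V_λ`. -/
abbrev Emb (lam : Ordinal.{u}) : Type (u + 1) := VSet lam ↪ₑ[setLanguage] VSet lam

/-- The restriction of `k` to `V_α`, as a set of ordered pairs. -/
noncomputable def restr {lam : Ordinal.{u}} (k : Emb lam) (α : Ordinal.{u}) : ZFSet.{u} :=
  ZFSet.sep (fun p => ∃ x : VSet lam, x.1 ∈ V_ α ∧ p = ZFSet.pair x.1 (k x).1)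
    (ZFSet.prod (V_ α) (V_ lam))

/-- `l` is the result `⋃ α < λ, j (k ↾ V_α)` of applying `j` to `k`. -/
def IsApplication {lam : Ordinal.{u}} (j k l : Emb lam) : Prop :=
  ∀ x y : VSet lam, l x = y ↔
    ∃ α < lam, ∃ w : VSet lam, w.1 = restr k α ∧ ZFSet.pair x.1 y.1 ∈ (j w).1

/-- `κ` is the critical point of `j`, the least ordinal below `λ` that is moved by `j`. -/
def IsCrit {lam : Ordinal.{u}} (j : Emb lam) (κ : Ordinal.{u}) : Prop :=
  IsLeast {α : Ordinal.{u} | ∃ x : VSet lam, x.1 = α.toZFSet ∧ j x ≠ x} κ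

/-- The relation `j ≡^γ k`: `j x ∩ V_γ = k x ∩ V_γ` for all `x ∈ V_γ`. -/
def rankEquiv (lam γ : Ordinal.{u}) : Setoid (Emb lam) where
  r j k := ∀ x : VSet lam, x.1 ∈ V_ γ → (j x).1 ∩ V_ γ = (k x).1 ∩ V_ γ
  iseqv := ⟨fun _ _ _ => rfl, fun h x hx => (h x hx).symm,
    fun h h' x hx => (h x hx).trans (h' x hx)⟩

theorem rankEquiv_mono {lam γ δ : Ordinal.{u}} (hγ : γ ≤ δ) {j k : Emb lam}
    (h : rankEquiv lam δ j k) : rankEquiv lam γ j k := by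
  intro x hx
  have hsub := ZFSet.vonNeumann_subset_of_le hγ
  have hx' := h x (hsub hx)
  ext y
  have hy := ZFSet.ext_iff.1 hx' y
  simp only [ZFSet.mem_inter] at hy ⊢
  constructor
  · rintro ⟨h₁, h₂⟩
    exact ⟨(hy.1 ⟨h₁, hsub h₂⟩).1, h₂⟩
  · rintro ⟨h₁, h₂⟩
    exact ⟨(hy.2 ⟨h₁, hsub h₂⟩).1, h₂⟩

/-- The topology of `E_λ`: a set `U` is open iff for each `j ∈ U` there is `γ < λ` such that every
`k` that agrees with `j` on `V_γ` is in `U`. (The case `γ = 0` is allowed separately only to have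
a topology for `λ = 0`, too.) -/
instance (lam : Ordinal.{u}) : TopologicalSpace (Emb lam) where
  IsOpen U := ∀ j ∈ U, ∃ γ : Ordinal.{u}, (γ < lam ∨ γ = 0) ∧
    ∀ k : Emb lam, (∀ x : VSet lam, x.1 ∈ V_ γ → j x = k x) → k ∈ U
  isOpen_univ := fun _ _ => ⟨0, Or.inr rfl, fun _ _ => trivial⟩
  isOpen_inter := by
    rintro U W hU hW j ⟨hjU, hjW⟩
    obtain ⟨γ, hγ, h⟩ := hU j hjU
    obtain ⟨δ, hδ, h'⟩ := hW j hjW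
    refine ⟨max γ δ, ?_, fun k hk => ⟨h k fun x hx => hk x ?_, h' k fun x hx => hk x ?_⟩⟩
    · rcases max_choice γ δ with e | e <;> rw [e] <;> assumption
    · exact ZFSet.vonNeumann_subset_of_le (le_max_left γ δ) hx
    · exact ZFSet.vonNeumann_subset_of_le (le_max_right γ δ) hx
  isOpen_sUnion := by
    rintro S hS j ⟨U, hU, hj⟩
    obtain ⟨γ, hγ, h⟩ := hS U hU j hj
    exact ⟨γ, hγ, fun k hk => ⟨U, hU, h k hk⟩⟩

/-- The sequence of quotients `E_λ / ≡^(κ n)`. -/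
abbrev EmbQuot {lam : Ordinal.{u}} [LDMonoid (Emb lam)] {κ : ℕ → Ordinal.{u}}
    (h : ∀ n, IsLDCongruence (rankEquiv lam (κ n))) (n : ℕ) : Type (u + 1) :=
  LDQuot (rankEquiv lam (κ n)) (h n)

/-- The transitional maps `E_λ / ≡^(κ (n+1)) → E_λ / ≡^(κ n)`, `[j] ↦ [j]`. -/
def embTransition {lam : Ordinal.{u}} [LDMonoid (Emb lam)] {κ : ℕ → Ordinal.{u}}
    (hκ : Monotone κ) (h : ∀ n, IsLDCongruence (rankEquiv lam (κ n))) (n : ℕ) :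
    EmbQuot h (n + 1) →◃ EmbQuot h n where
  toFun := Quotient.map id fun _ _ hjk => rankEquiv_mono (hκ (Nat.le_succ n)) hjk
  map_act' := by
    rintro ⟨j⟩ ⟨k⟩
    rfl

end RankIntoRank

open RankIntoRank

/-! Parameter-free definable relations on `V_λ` are preserved by every embedding. Since a critical
point `κ` satisfies `κ + 1 < λ`, the ordinal `λ` is a limit, so pairs, bounded relations and
restrictions `k ↾ V_α` are elements of `V_λ`. For each formula, "this function preserves the
formula" is a first-order property of `k ↾ V_α`, hence also of `j (k ↾ V_α)`; the union of these
functions is the embedding `j ◃ k`. The basic law `j ∘ k = (j ◃ k) ∘ j` and elementarity give the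
LD-monoid axioms, and `crit (j ◃ k) = j (crit k)`.

The deep ingredient is Kunen's argument (`CritAt.ordMap_ne_self`, `CritAt.exists_lt_iterate`): the
iterates of an embedding on its critical point are cofinal in `λ`. It makes the quotients
permutative: consecutive Fibonacci terms have a constant product `e`, which drives their critical
points past all `e^i (crit e)` (`exists_fixes_fib`). It also shows that the abstract order of
critical points in `E_λ / ≡^γ` is the order of the true critical points truncated at `γ`
(`critLE_mk_iff`), and it supplies an `r` with `crit r = κ n` and `r (κ n) ≥ κ (n + 1)`, which
identifies the kernels of the transitional maps.

If `j α < γ`, then `≡^γ` determines `j` on `V_α` (`eq_of_rankEquiv`). This yields the topology, and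
also the surjectivity of `Γ`: the condition defining `EE` says that the representatives `A m` of a
thread satisfy `A m (κ n) < κ m` for some `m`, so they are eventually constant at each point of
`V_λ`, and their limit is elementary because a formula involves only finitely many points. -/

namespace RankIntoRank

/-! ### Definable relations on `V_λ` -/

section Definability

variable {lam : Ordinal.{u}}

/-- A relation on `V_λ`, given as a predicate on assignments of the variables `0, 1, 2, …`, is
definable if it is defined by a first-order formula without parameters. -/
def Dfn (P : (ℕ → VSet lam) → Prop) : Prop :=
  ∃ φ : setLanguage.Formula ℕ, ∀ v, φ.Realize v ↔ P v

namespace Dfn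

open FirstOrder.Language

variable {P Q : (ℕ → VSet lam) → Prop} {a b c : ℕ}

theorem mem : Dfn (lam := lam) fun v => (v a).1 ∈ (v b).1 :=
  ⟨Relations.formula₂ (show setLanguage.Relations 2 from SetRel.mem) (Term.var a) (Term.var b),
    fun _ => Formula.realize_rel₂⟩

theorem eq : Dfn (lam := lam) fun v => v a = v b :=
  ⟨Term.equal (Term.var a) (Term.var b), fun v => by simp [Formula.realize_equal]⟩

theorem not (h : Dfn P) : Dfn fun v => ¬ P v := by
  obtain ⟨φ, h⟩ := h
  exact ⟨∼φ, fun v => by rw [Formula.realize_not, h]⟩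

theorem imp (h : Dfn P) (h' : Dfn Q) : Dfn fun v => P v → Q v := by
  obtain ⟨φ, h⟩ := h
  obtain ⟨ψ, h'⟩ := h'
  exact ⟨φ.imp ψ, fun v => by rw [Formula.realize_imp, h, h']⟩

theorem congr (h : Dfn P) (e : ∀ v, P v ↔ Q v) : Dfn Q := by
  obtain rfl : P = Q := funext fun v => propext (e v)
  exact h

theorem and (h : Dfn P) (h' : Dfn Q) : Dfn fun v => P v ∧ Q v :=
  (h.imp h'.not).not.congr fun v => by tauto

theorem or (h : Dfn P) (h' : Dfn Q) : Dfn fun v => P v ∨ Q v :=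
  (h.not.imp h').congr fun v => by tauto

theorem iff (h : Dfn P) (h' : Dfn Q) : Dfn fun v => (P v ↔ Q v) :=
  ((h.imp h').and (h'.imp h)).congr fun v => by tauto

/-- De Bruijn convention: the quantified tuple occupies the variables below `n`, and the free
variables are shifted up by `n`. -/
theorem all_fin {n : ℕ} {P : (ℕ → VSet lam) → (Fin n → VSet lam) → Prop}
    (h : Dfn fun v => P (fun k => v (k + n)) fun i => v i) : Dfn fun v => ∀ x, P v x := by
  obtain ⟨φ, h⟩ := h
  refine ⟨(φ.relabel fun k => if hk : k < n then Sum.inr (⟨k, hk⟩ : Fin n)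
    else Sum.inl (k - n)).iAlls (Fin n), fun v => ?_⟩
  rw [Formula.realize_iAlls]
  refine forall_congr' fun x => ?_
  rw [Formula.realize_relabel, h]
  simp

theorem all {P : (ℕ → VSet lam) → VSet lam → Prop}
    (h : Dfn fun v => P (fun k => v (k + 1)) (v 0)) : Dfn fun v => ∀ x, P v x :=
  (all_fin (n := 1) (P := fun v x => P v (x 0)) h).congr fun _ =>
    ⟨fun h x => h fun _ => x, fun h x => h (x 0)⟩

theorem ex {P : (ℕ → VSet lam) → VSet lam → Prop}
    (h : Dfn fun v => P (fun k => v (k + 1)) (v 0)) : Dfn fun v => ∃ x, P v x :=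
  (all (P := fun v x => ¬ P v x) h.not).not.congr fun _ => by push Not; rfl

theorem all_index {n : ℕ} {P : Fin n → (ℕ → VSet lam) → Prop} (h : ∀ i, Dfn (P i)) :
    Dfn fun v => ∀ i, P i v := by
  choose φ h using h
  exact ⟨Formula.iInf φ, fun v => by simp [h]⟩

theorem realize {n : ℕ} (φ : setLanguage.Formula (Fin n)) (e : Fin n → ℕ) :
    Dfn (lam := lam) fun v => φ.Realize fun i => v (e i) :=
  ⟨φ.relabel e, fun v => by rw [Formula.realize_relabel]; rfl⟩

theorem preserve (h : Dfn P) (j : Emb lam) (v : ℕ → VSet lam) : P (fun k => j (v k)) ↔ P v := by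
  obtain ⟨φ, h⟩ := h
  rw [← h, ← h]
  exact j.map_formula φ v

end Dfn

variable (j : Emb lam)

theorem preserve₁ {Q : VSet lam → Prop} (h : Dfn fun v => Q (v 0)) (a : VSet lam) :
    Q (j a) ↔ Q a :=
  h.preserve j fun _ => a

theorem preserve₂ {Q : VSet lam → VSet lam → Prop} (h : Dfn fun v => Q (v 0) (v 1))
    (a b : VSet lam) : Q (j a) (j b) ↔ Q a b :=
  -- The assignment `a, b, b, b, …`; only the first entries matter.
  h.preserve j fun n => [a].getD n b

theorem preserve₃ {Q : VSet lam → VSet lam → VSet lam → Prop}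
    (h : Dfn fun v => Q (v 0) (v 1) (v 2)) (a b c : VSet lam) :
    Q (j a) (j b) (j c) ↔ Q a b c :=
  h.preserve j fun n => [a, b].getD n c

theorem mem_of_mem {x : VSet lam} {y : ZFSet.{u}} (h : y ∈ x.1) : y ∈ V_ lam :=
  ZFSet.isTransitive_vonNeumann lam x.1 x.2 h

theorem VSet.eq_iff_forall_mem {x y : VSet lam} :
    x = y ↔ ∀ z : VSet lam, z.1 ∈ x.1 ↔ z.1 ∈ y.1 := by
  refine ⟨fun h z => by rw [h],
    fun h => Subtype.ext (ZFSet.ext fun z => ⟨fun hz => ?_, fun hz => ?_⟩)⟩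
  · exact (h ⟨z, mem_of_mem hz⟩).1 hz
  · exact (h ⟨z, mem_of_mem hz⟩).2 hz

/-- Being an ordinal is a bounded condition, hence absolute for the transitive set `V_λ`. -/
theorem isOrdinal_iff (x : VSet lam) : x.1.IsOrdinal ↔
    (∀ y : VSet lam, y.1 ∈ x.1 → ∀ z : VSet lam, z.1 ∈ y.1 → z.1 ∈ x.1) ∧
    ∀ y : VSet lam, y.1 ∈ x.1 → ∀ z : VSet lam, z.1 ∈ y.1 →
      ∀ w : VSet lam, w.1 ∈ z.1 → w.1 ∈ y.1 := by
  constructor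
  · exact fun h => ⟨fun y hy z hz => h.mem_trans hz hy, fun y hy z hz w hw => h.mem_trans' hw hz hy⟩
  · rintro ⟨h₁, h₂⟩
    have h₃ : ∀ y ∈ x.1, ∀ z ∈ y, z ∈ x.1 := fun y hy z hz =>
      h₁ ⟨y, mem_of_mem hy⟩ hy ⟨z, mem_of_mem (y := z) (x := ⟨y, mem_of_mem hy⟩) hz⟩ hz
    refine ⟨fun y hy z hz => h₃ y hy z hz, fun {w z y} hw hz hy => ?_⟩
    exact h₂ ⟨y, mem_of_mem hy⟩ hy ⟨z, mem_of_mem (h₃ y hy z hz)⟩ hz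
      ⟨w, mem_of_mem (h₃ z (h₃ y hy z hz) w hw)⟩ hw

theorem Dfn.isOrdinal {a : ℕ} : Dfn (lam := lam) fun v => (v a).1.IsOrdinal :=
  (Dfn.and (.all (.imp .mem (.all (.imp .mem .mem))))
    (.all (.imp .mem (.all (.imp .mem (.all (.imp .mem .mem))))))).congr
    fun v => (isOrdinal_iff (v a)).symm

theorem emb_mem_iff {x y : VSet lam} : (j x).1 ∈ (j y).1 ↔ x.1 ∈ y.1 :=
  preserve₂ j (Q := fun x y => x.1 ∈ y.1) .mem x y

theorem emb_isOrdinal {x : VSet lam} : (j x).1.IsOrdinal ↔ x.1.IsOrdinal :=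
  preserve₁ j (Q := fun x => x.1.IsOrdinal) .isOrdinal x

/-- An ordinal `α < λ` as an element of `V_λ`. -/
noncomputable def ordV (α : Ordinal.{u}) (h : α < lam) : VSet lam :=
  ⟨α.toZFSet, ZFSet.mem_vonNeumann.2 (by rwa [Ordinal.rank_toZFSet])⟩

theorem rank_lt (x : VSet lam) : x.1.rank < lam := ZFSet.mem_vonNeumann.1 x.2

theorem IsCrit.lt {κ : Ordinal.{u}} {j : Emb lam} (h : IsCrit j κ) : κ < lam := by
  obtain ⟨x, hx, -⟩ := h.1
  simpa [hx] using rank_lt x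

theorem IsCrit.apply_ne {κ : Ordinal.{u}} {j : Emb lam} (h : IsCrit j κ) :
    j (ordV κ h.lt) ≠ ordV κ h.lt := by
  obtain ⟨x, hx, hj⟩ := h.1
  rwa [show ordV κ h.lt = x from Subtype.ext hx.symm]

theorem IsCrit.apply_eq {κ α : Ordinal.{u}} {j : Emb lam} (h : IsCrit j κ) (hα : α < κ) :
    j (ordV α (hα.trans h.lt)) = ordV α (hα.trans h.lt) := by
  by_contra hj
  exact hα.not_ge (h.2 ⟨_, rfl, hj⟩)

/-- The ordinal `j κ` includes `κ`, whose elements are fixed, and differs from it; so `κ + 1 ≤ j κ <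
λ`. This is argued with ordinals only, as ranks are not yet known to be preserved. -/
theorem IsCrit.add_one_lt {κ : Ordinal.{u}} {j : Emb lam} (h : IsCrit j κ) : κ + 1 < lam := by
  have ho : (j (ordV κ h.lt)).1.IsOrdinal := (emb_isOrdinal j).2 (ZFSet.isOrdinal_toZFSet κ)
  have hsub : κ.toZFSet ⊆ (j (ordV κ h.lt)).1 := by
    intro x hx
    obtain ⟨α, hα, rfl⟩ := Ordinal.mem_toZFSet_iff.1 hx
    have := (emb_mem_iff j (x := ordV α (hα.trans h.lt)) (y := ordV κ h.lt)).2
      (Ordinal.toZFSet_mem_toZFSet_iff.2 hα)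
    rwa [h.apply_eq hα] at this
  rw [← ho.toZFSet_rank_eq, Ordinal.toZFSet_subset_toZFSet_iff] at hsub
  have hne : κ ≠ (j (ordV κ h.lt)).1.rank := by
    intro e
    refine h.apply_ne (Subtype.ext ?_)
    rw [← ho.toZFSet_rank_eq, ← e]
    rfl
  exact (Order.add_one_le_of_lt (lt_of_le_of_ne hsub hne)).trans_lt (rank_lt _)

theorem isSuccLimit_of_isCrit {κ : ℕ → Ordinal.{u}} (hcof : ∀ α < lam, ∃ n, α ≤ κ n)
    (hcrit : ∀ n, ∃ j : Emb lam, IsCrit j (κ n)) : Order.IsSuccLimit lam := by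
  refine ⟨?_, ?_⟩
  · obtain ⟨j, hj⟩ := hcrit 0
    exact fun h => (h.eq_bot ▸ hj.lt).not_ge bot_le
  · intro α hα
    obtain ⟨n, hn⟩ := hcof α hα.lt
    obtain ⟨j, hj⟩ := hcrit n
    exact hα.2 (Order.lt_add_one_iff.2 hn) hj.add_one_lt

end Definability

/-! ### Pairs and ranks in `V_λ`, for a limit ordinal `λ` -/

section Limit

variable {lam : Ordinal.{u}} [hlam : Fact (Order.IsSuccLimit lam)]

theorem add_one_lt_lam {α : Ordinal.{u}} (h : α < lam) : α + 1 < lam := by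
  simpa using hlam.out.succ_lt h

theorem rank_pair (x y : ZFSet.{u}) :
    (ZFSet.pair x y).rank = max x.rank y.rank + 1 + 1 := by
  simp only [ZFSet.pair, ZFSet.rank_pair, ZFSet.rank_singleton, Order.succ_eq_add_one]
  rw [max_add_add_right, max_eq_right]
  · rw [max_add_add_right]
  · simp

theorem pair_mem_vonNeumann {γ : Ordinal.{u}} (hγ : Order.IsSuccLimit γ) {x y : ZFSet.{u}}
    (hx : x ∈ V_ γ) (hy : y ∈ V_ γ) : ZFSet.pair x y ∈ V_ γ := by
  rw [ZFSet.mem_vonNeumann] at *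
  rw [rank_pair]
  simpa using hγ.succ_lt (hγ.succ_lt (max_lt hx hy))

/-- The ordered pair in `V_λ`. -/
noncomputable def vpair (x y : VSet lam) : VSet lam :=
  ⟨ZFSet.pair x.1 y.1, pair_mem_vonNeumann hlam.out x.2 y.2⟩

theorem vpair_inj {x y x' y' : VSet lam} : vpair x y = vpair x' y' ↔ x = x' ∧ y = y' := by
  rw [vpair, vpair, Subtype.mk.injEq, ZFSet.pair_inj, Subtype.ext_iff, Subtype.ext_iff]

theorem eq_vpair_iff (p x y : VSet lam) : p = vpair x y ↔
    ∀ z : VSet lam, z.1 ∈ p.1 ↔ (∀ w : VSet lam, w.1 ∈ z.1 ↔ w = x) ∨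
      ∀ w : VSet lam, w.1 ∈ z.1 ↔ w = x ∨ w = y := by
  have key : ∀ z : VSet lam, ((∀ w : VSet lam, w.1 ∈ z.1 ↔ w = x) ∨
      ∀ w : VSet lam, w.1 ∈ z.1 ↔ w = x ∨ w = y) ↔ z.1 ∈ (vpair x y).1 := by
    intro z
    change _ ↔ z.1 ∈ ({{x.1}, {x.1, y.1}} : ZFSet)
    rw [ZFSet.mem_pair, ZFSet.ext_iff, ZFSet.ext_iff]
    simp only [ZFSet.mem_singleton, ZFSet.mem_pair]
    refine or_congr ⟨fun h w => ⟨fun hw => ?_, ?_⟩, fun h w => by rw [h, Subtype.ext_iff]⟩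
      ⟨fun h w => ⟨fun hw => ?_, ?_⟩, fun h w => by rw [h, Subtype.ext_iff, Subtype.ext_iff]⟩
    · exact congrArg Subtype.val ((h ⟨w, mem_of_mem hw⟩).1 hw)
    · rintro rfl
      exact (h x).2 rfl
    · exact ((h ⟨w, mem_of_mem hw⟩).1 hw).imp (congrArg Subtype.val) (congrArg Subtype.val)
    · rintro (rfl | rfl)
      · exact (h x).2 (.inl rfl)
      · exact (h y).2 (.inr rfl)
  rw [VSet.eq_iff_forall_mem]
  simp only [key]

theorem Dfn.eq_vpair {p a b : ℕ} : Dfn (lam := lam) fun v => v p = vpair (v a) (v b) :=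
  (Dfn.all (.iff .mem (.or (.all (.iff .mem .eq)) (.all (.iff .mem (.or .eq .eq)))))).congr
    fun v => (eq_vpair_iff (v p) (v a) (v b)).symm

theorem Dfn.vpair_mem {r a b : ℕ} : Dfn (lam := lam) fun v => (vpair (v a) (v b)).1 ∈ (v r).1 :=
  (Dfn.ex (.and .eq_vpair .mem)).congr (P := fun v => ∃ p, p = vpair (v a) (v b) ∧ p.1 ∈ (v r).1)
    fun v => by simp

theorem emb_vpair (j : Emb lam) (x y : VSet lam) : j (vpair x y) = vpair (j x) (j y) :=
  (preserve₃ j (Q := fun p x y => p = vpair x y) .eq_vpair _ x y).2 rfl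

theorem emb_vpair_mem (j : Emb lam) {r x y : VSet lam} :
    (vpair (j x) (j y)).1 ∈ (j r).1 ↔ (vpair x y).1 ∈ r.1 := by
  rw [← emb_vpair, emb_mem_iff]

/-- The set of all pairs of elements of `V_β` that satisfy a relation. -/
noncomputable def relSet (β : Ordinal.{u}) (h : β < lam) (p : VSet lam → VSet lam → Prop) :
    VSet lam :=
  ⟨ZFSet.sep (fun z => ∃ x y : VSet lam, z = (vpair x y).1 ∧ p x y) (ZFSet.prod (V_ β) (V_ β)), by
    rw [ZFSet.mem_vonNeumann]
    refine lt_of_le_of_lt (ZFSet.rank_le_iff.2 fun z hz => ?_)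
      (add_one_lt_lam (add_one_lt_lam h))
    obtain ⟨a, ha, b, hb, rfl⟩ := ZFSet.mem_prod.1 (ZFSet.mem_sep.1 hz).1
    rw [ZFSet.mem_vonNeumann] at ha hb
    rw [rank_pair]
    simpa using ⟨ha, hb⟩⟩

theorem mem_relSet {β : Ordinal.{u}} {h : β < lam} {p : VSet lam → VSet lam → Prop}
    {z : ZFSet.{u}} : z ∈ (relSet β h p).1 ↔
      ∃ x y : VSet lam, z = (vpair x y).1 ∧ x.1.rank < β ∧ y.1.rank < β ∧ p x y := by
  rw [relSet, ZFSet.mem_sep]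
  constructor
  · rintro ⟨h₁, x, y, rfl, hp⟩
    have := ZFSet.pair_mem_prod.1 h₁
    rw [ZFSet.mem_vonNeumann, ZFSet.mem_vonNeumann] at this
    exact ⟨x, y, rfl, this.1, this.2, hp⟩
  · rintro ⟨x, y, rfl, hx, hy, hp⟩
    refine ⟨ZFSet.pair_mem_prod.2 ?_, x, y, rfl, hp⟩
    rw [ZFSet.mem_vonNeumann, ZFSet.mem_vonNeumann]
    exact ⟨hx, hy⟩

theorem vpair_mem_relSet {β : Ordinal.{u}} {h : β < lam} {p : VSet lam → VSet lam → Prop}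
    {x y : VSet lam} : (vpair x y).1 ∈ (relSet β h p).1 ↔
      x.1.rank < β ∧ y.1.rank < β ∧ p x y := by
  rw [mem_relSet]
  constructor
  · rintro ⟨x', y', e, hh⟩
    obtain ⟨rfl, rfl⟩ := vpair_inj.1 (Subtype.ext e)
    exact hh
  · exact fun hh => ⟨x, y, rfl, hh⟩

theorem relSet_congr {β : Ordinal.{u}} {h : β < lam} {p q : VSet lam → VSet lam → Prop}
    (e : ∀ x y : VSet lam, x.1.rank < β → y.1.rank < β → (p x y ↔ q x y)) :
    relSet β h p = relSet β h q := by
  refine Subtype.ext (ZFSet.ext fun z => ?_)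
  rw [mem_relSet, mem_relSet]
  refine exists_congr fun x => exists_congr fun y => and_congr_right fun _ =>
    and_congr_right fun hx => and_congr_right fun hy => e x y hx hy

theorem rank_relSet_lt {β γ : Ordinal.{u}} {h : β < lam} {p : VSet lam → VSet lam → Prop}
    (hβ : β < γ) (hγ : Order.IsSuccLimit γ) : (relSet β h p).1.rank < γ := by
  refine lt_of_le_of_lt (ZFSet.rank_le_iff.2 fun z hz => ?_)
    (hγ.succ_lt (hγ.succ_lt hβ))
  obtain ⟨x, y, rfl, hx, hy, -⟩ := mem_relSet.1 hz
  rw [vpair, rank_pair]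
  simpa using ⟨hx, hy⟩

/-- Ranks are compared by a simulation, which avoids defining the rank function inside `V_λ`.
Comparison of ranks, cut off just above `x` and `y`, is itself such a relation and is a set in
`V_λ`; conversely any simulation respects ranks by `∈`-induction. -/
theorem rank_le_rank_iff (x y : VSet lam) : x.1.rank ≤ y.1.rank ↔
    ∃ r : VSet lam, (vpair x y).1 ∈ r.1 ∧ ∀ a b : VSet lam, (vpair a b).1 ∈ r.1 →
      ∀ c : VSet lam, c.1 ∈ a.1 → ∃ d : VSet lam, d.1 ∈ b.1 ∧ (vpair c d).1 ∈ r.1 := by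
  constructor
  · intro h
    refine ⟨relSet (max x.1.rank y.1.rank + 1)
      (add_one_lt_lam (max_lt (rank_lt x) (rank_lt y))) fun a b => a.1.rank ≤ b.1.rank,
      vpair_mem_relSet.2 ⟨by simp, by simp, h⟩, fun a b hab c hc => ?_⟩
    obtain ⟨ha, hb, hle⟩ := vpair_mem_relSet.1 hab
    obtain ⟨d, hd, hcd⟩ := ZFSet.lt_rank_iff.1 ((ZFSet.rank_lt_of_mem hc).trans_le hle)
    exact ⟨⟨d, mem_of_mem hd⟩, hd, vpair_mem_relSet.2
      ⟨(ZFSet.rank_lt_of_mem hc).trans ha, (ZFSet.rank_lt_of_mem hd).trans hb, hcd⟩⟩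
  · rintro ⟨r, hxy, hr⟩
    have key : ∀ a : ZFSet.{u}, ∀ (ha : a ∈ V_ lam) (b : VSet lam),
        (vpair ⟨a, ha⟩ b).1 ∈ r.1 → a.rank ≤ b.1.rank := by
      intro a
      induction a using ZFSet.inductionOn with
      | h a ih =>
        intro ha b hab
        refine ZFSet.rank_le_iff.2 fun c hc => ?_
        have hc' : c ∈ V_ lam := mem_of_mem (x := ⟨a, ha⟩) hc
        obtain ⟨d, hd, hcd⟩ := hr _ _ hab ⟨c, hc'⟩ hc
        exact (ih c hc hc' d hcd).trans_lt (ZFSet.rank_lt_of_mem hd)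
    exact key x.1 x.2 y hxy

theorem Dfn.rank_le {a b : ℕ} : Dfn (lam := lam) fun v => (v a).1.rank ≤ (v b).1.rank :=
  (Dfn.ex (.and .vpair_mem (.all (.all (.imp .vpair_mem (.all (.imp .mem
    (.ex (.and .mem .vpair_mem))))))))).congr fun v => (rank_le_rank_iff (v a) (v b)).symm

theorem Dfn.rank_lt {a b : ℕ} : Dfn (lam := lam) fun v => (v a).1.rank < (v b).1.rank :=
  (Dfn.rank_le (a := b) (b := a)).not.congr fun _ => not_le

end Limit

/-! ### The action of an embedding on the ordinals -/

section OrdMap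

variable {lam : Ordinal.{u}}

open Classical in
/-- The action of an embedding on the ordinals; it is the identity on the ordinals `≥ λ`. -/
noncomputable def ordMap (j : Emb lam) (α : Ordinal.{u}) : Ordinal.{u} :=
  if h : α < lam then (j (ordV α h)).1.rank else α

/-- The embedding fixes all ordinals below `γ`. -/
def Fixes (j : Emb lam) (γ : Ordinal.{u}) : Prop := ∀ α < γ, ordMap j α = α

theorem Fixes.mono {j : Emb lam} {γ δ : Ordinal.{u}} (h : Fixes j δ) (hγ : γ ≤ δ) : Fixes j γ :=
  fun α hα => h α (hα.trans_le hγ)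

theorem rank_ordV (α : Ordinal.{u}) (h : α < lam) : (ordV α h).1.rank = α :=
  Ordinal.rank_toZFSet α

/-- `V_α` as an element of `V_λ`. -/
noncomputable def levV (α : Ordinal.{u}) (h : α < lam) : VSet lam :=
  ⟨V_ α, ZFSet.vonNeumann_mem_of_lt h⟩

theorem mem_levV {α : Ordinal.{u}} {h : α < lam} {x : ZFSet.{u}} :
    x ∈ (levV α h).1 ↔ x.rank < α := ZFSet.mem_vonNeumann

variable (j k l : Emb lam)

theorem ordMap_lt {α : Ordinal.{u}} (h : α < lam) : ordMap j α < lam := by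
  rw [ordMap, dif_pos h]
  exact rank_lt _

theorem ordMap_of_le {α : Ordinal.{u}} (h : lam ≤ α) : ordMap j α = α := by
  rw [ordMap, dif_neg h.not_gt]

variable [hlam : Fact (Order.IsSuccLimit lam)]

theorem rank_emb_le {x y : VSet lam} : (j x).1.rank ≤ (j y).1.rank ↔ x.1.rank ≤ y.1.rank :=
  preserve₂ j (Q := fun x y => x.1.rank ≤ y.1.rank) .rank_le x y

theorem rank_emb (x : VSet lam) : (j x).1.rank = ordMap j x.1.rank := by
  rw [ordMap, dif_pos (rank_lt x)]
  apply le_antisymm <;> rw [rank_emb_le, rank_ordV]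

theorem ordMap_strictMono : StrictMono (ordMap j) := by
  intro α β h
  rcases lt_or_ge β lam with hβ | hβ
  · have hα := h.trans hβ
    rw [ordMap, ordMap, dif_pos hα, dif_pos hβ, ← not_le, rank_emb_le, rank_ordV, rank_ordV]
    exact h.not_ge
  · rw [ordMap_of_le j hβ]
    rcases lt_or_ge α lam with hα | hα
    · exact (ordMap_lt j hα).trans_le hβ
    · rwa [ordMap_of_le j hα]

theorem le_ordMap (α : Ordinal.{u}) : α ≤ ordMap j α := (ordMap_strictMono j).le_apply

theorem ordMap_zero : ordMap j 0 = 0 := by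
  have h := preserve₁ j (Q := fun x => ∀ z : VSet lam, ¬ z.1.rank < x.1.rank)
    (.all (.not .rank_lt)) (ordV 0 hlam.out.bot_lt)
  simp only [rank_ordV, rank_emb, not_lt_zero, not_false_eq_true, implies_true, iff_true] at h
  by_contra hne
  exact h (ordV 0 hlam.out.bot_lt) (by rw [rank_ordV]; exact pos_iff_ne_zero.2 hne)

theorem rank_eq_add_one_iff (x y : VSet lam) : y.1.rank = x.1.rank + 1 ↔
    x.1.rank < y.1.rank ∧ ∀ z : VSet lam, z.1.rank < y.1.rank → z.1.rank ≤ x.1.rank := by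
  constructor
  · intro h
    rw [h]
    exact ⟨by simp, fun z hz => Order.lt_add_one_iff.1 hz⟩
  · rintro ⟨h₁, h₂⟩
    refine le_antisymm ?_ (Order.add_one_le_of_lt h₁)
    by_contra! h
    have := h₂ (ordV _ (add_one_lt_lam (rank_lt x))) (by rwa [rank_ordV])
    rw [rank_ordV] at this
    exact this.not_gt (Order.lt_add_one_iff.2 le_rfl)

theorem ordMap_add_one {α : Ordinal.{u}} (h : α < lam) : ordMap j (α + 1) = ordMap j α + 1 := by
  have hd : Dfn (lam := lam) fun v => (v 1).1.rank = (v 0).1.rank + 1 :=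
    (Dfn.and .rank_lt (.all (.imp .rank_lt .rank_le))).congr
      fun v => (rank_eq_add_one_iff (v 0) (v 1)).symm
  have := preserve₂ j (Q := fun x y => y.1.rank = x.1.rank + 1) hd (ordV α h)
    (ordV (α + 1) (add_one_lt_lam h))
  simpa only [rank_emb, rank_ordV, iff_true] using this

theorem emb_levV {α : Ordinal.{u}} (h : α < lam) : j (levV α h) = levV _ (ordMap_lt j h) := by
  have := (preserve₂ j (Q := fun d a => ∀ x : VSet lam, x.1 ∈ d.1 ↔ x.1.rank < a.1.rank)
    (.all (.iff .mem .rank_lt)) (levV α h) (ordV α h)).2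
    fun x => by rw [mem_levV, rank_ordV]
  rw [VSet.eq_iff_forall_mem]
  intro z
  rw [this z, mem_levV, rank_emb, rank_ordV]

/-- Induction on the rank: an element of `j x` has rank below `j (rank x) = rank x`, so it is fixed
and hence lies in `x`. -/
theorem Fixes.apply {j : Emb lam} {γ : Ordinal.{u}} (h : Fixes j γ) :
    ∀ x : VSet lam, x.1.rank < γ → j x = x := by
  suffices ∀ α < γ, ∀ x : VSet lam, x.1.rank = α → j x = x from fun x hx => this _ hx x rfl
  intro α
  induction α using WellFoundedLT.induction with
  | ind α ih =>
    rintro hα x rfl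
    rw [VSet.eq_iff_forall_mem]
    intro z
    constructor
    · intro hz
      have hr := ZFSet.rank_lt_of_mem hz
      rw [rank_emb, h _ hα] at hr
      rwa [← ih _ hr (hr.trans hα) z rfl, emb_mem_iff] at hz
    · intro hz
      have hr := ZFSet.rank_lt_of_mem hz
      rwa [← ih _ hr (hr.trans hα) z rfl, emb_mem_iff]

theorem ordMap_comp (α : Ordinal.{u}) : ordMap (j.comp k) α = ordMap j (ordMap k α) := by
  rcases lt_or_ge α lam with h | h
  · have := rank_emb (j.comp k) (ordV α h)
    rwa [rank_ordV, FirstOrder.Language.ElementaryEmbedding.comp_apply, rank_emb, rank_emb,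
      rank_ordV, eq_comm] at this
  · rw [ordMap_of_le _ h, ordMap_of_le k h, ordMap_of_le j h]

/-! ### Application of embeddings -/

/-- The restriction of `k` to `V_α`, as an element of `V_λ`. -/
noncomputable def graph (α : Ordinal.{u}) (h : α < lam) : VSet lam :=
  relSet (max α (ordMap k α)) (max_lt h (ordMap_lt k h)) fun x y => x.1.rank < α ∧ y = k x

theorem mem_graph {α : Ordinal.{u}} {h : α < lam} {z : ZFSet.{u}} :
    z ∈ (graph k α h).1 ↔ ∃ x : VSet lam, x.1.rank < α ∧ z = (vpair x (k x)).1 := by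
  rw [graph, mem_relSet]
  constructor
  · rintro ⟨x, y, rfl, -, -, hx, rfl⟩
    exact ⟨x, hx, rfl⟩
  · rintro ⟨x, hx, rfl⟩
    refine ⟨x, _, rfl, lt_max_of_lt_left hx, lt_max_of_lt_right ?_, hx, rfl⟩
    rw [rank_emb]
    exact ordMap_strictMono k hx

theorem vpair_mem_graph {α : Ordinal.{u}} {h : α < lam} {x y : VSet lam} :
    (vpair x y).1 ∈ (graph k α h).1 ↔ x.1.rank < α ∧ y = k x := by
  rw [mem_graph]
  constructor
  · rintro ⟨x', hx, e⟩
    obtain ⟨rfl, rfl⟩ := vpair_inj.1 (Subtype.ext e)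
    exact ⟨hx, rfl⟩
  · rintro ⟨hx, rfl⟩
    exact ⟨x, hx, rfl⟩

theorem graph_val {α : Ordinal.{u}} (h : α < lam) : (graph k α h).1 = restr k α := by
  ext z
  rw [mem_graph, restr, ZFSet.mem_sep]
  constructor
  · rintro ⟨x, hx, rfl⟩
    have hx' := ZFSet.mem_vonNeumann.2 hx
    exact ⟨ZFSet.pair_mem_prod.2 ⟨hx', (k x).2⟩, x, hx', rfl⟩
  · rintro ⟨-, x, hx, rfl⟩
    exact ⟨x, ZFSet.mem_vonNeumann.1 hx, rfl⟩

-- By elementarity `j (k ↾ V_α)` is a function with domain `V_(j α)`, growing with `α`; this and the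
-- next three lemmas let these functions be glued.
variable {j k} in
theorem exists_vpair_mem_emb_graph {α : Ordinal.{u}} (h : α < lam) {x : VSet lam}
    (hx : x.1.rank < ordMap j α) : ∃ y, (vpair x y).1 ∈ (j (graph k α h)).1 := by
  refine (preserve₂ j (Q := fun f a => ∀ x : VSet lam, x.1.rank < a.1.rank →
    ∃ y, (vpair x y).1 ∈ f.1) (.all (.imp .rank_lt (.ex .vpair_mem))) _ (ordV α h)).2 ?_ x ?_
  · intro x hx
    rw [rank_ordV] at hx
    exact ⟨k x, (vpair_mem_graph k).2 ⟨hx, rfl⟩⟩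
  · rwa [rank_emb, rank_ordV]

variable {j k} in
theorem rank_lt_of_vpair_mem_emb_graph {α : Ordinal.{u}} {h : α < lam} {x y : VSet lam}
    (hx : (vpair x y).1 ∈ (j (graph k α h)).1) : x.1.rank < ordMap j α := by
  have := (preserve₂ j (Q := fun f a => ∀ x y : VSet lam, (vpair x y).1 ∈ f.1 →
    x.1.rank < a.1.rank) (.all (.all (.imp .vpair_mem .rank_lt))) (graph k α h) (ordV α h)).2
    (fun x y hxy => by rw [rank_ordV]; exact ((vpair_mem_graph k).1 hxy).1) x y hx
  rwa [rank_emb, rank_ordV] at this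

variable {j k} in
theorem emb_graph_unique {α : Ordinal.{u}} {h : α < lam} {x y z : VSet lam}
    (hy : (vpair x y).1 ∈ (j (graph k α h)).1) (hz : (vpair x z).1 ∈ (j (graph k α h)).1) :
    y = z := by
  refine (preserve₁ j (Q := fun f => ∀ x y z : VSet lam, (vpair x y).1 ∈ f.1 →
    (vpair x z).1 ∈ f.1 → y = z)
    (.all (.all (.all (.imp .vpair_mem (.imp .vpair_mem .eq))))) (graph k α h)).2 ?_ x y z hy hz
  intro x y z hy hz
  rw [((vpair_mem_graph k).1 hy).2, ((vpair_mem_graph k).1 hz).2]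

variable {j k} in
theorem emb_graph_mono {α β : Ordinal.{u}} {h : α < lam} {h' : β < lam} (hle : α ≤ β)
    {z : VSet lam} (hz : z.1 ∈ (j (graph k α h)).1) : z.1 ∈ (j (graph k β h')).1 := by
  refine (preserve₂ j (Q := fun f g => ∀ z : VSet lam, z.1 ∈ f.1 → z.1 ∈ g.1)
    (.all (.imp .mem .mem)) (graph k α h) (graph k β h')).2 ?_ z hz
  intro z hz
  rw [mem_graph] at hz ⊢
  obtain ⟨x, hx, e⟩ := hz
  exact ⟨x, hx.trans_le hle, e⟩

theorem exists_appl (x : VSet lam) :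
    ∃ y, ∃ α, ∃ h : α < lam, (vpair x y).1 ∈ (j (graph k α h)).1 := by
  have h := add_one_lt_lam (rank_lt x)
  obtain ⟨y, hy⟩ := exists_vpair_mem_emb_graph (j := j) (k := k) h
    ((Order.lt_add_one_iff.2 le_rfl).trans_le (le_ordMap j _))
  exact ⟨y, _, h, hy⟩

theorem vpair_mem_emb_graph_iff {α : Ordinal.{u}} {h : α < lam} {x y : VSet lam} :
    (vpair x y).1 ∈ (j (graph k α h)).1 ↔
      x.1.rank < ordMap j α ∧ y = (exists_appl j k x).choose := by
  obtain ⟨β, hβ, hc⟩ := (exists_appl j k x).choose_spec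
  have key : ∀ y, (vpair x y).1 ∈ (j (graph k α h)).1 → y = (exists_appl j k x).choose := by
    intro y hy
    rcases le_total α β with hle | hle
    · exact emb_graph_unique (emb_graph_mono hle hy) hc
    · exact emb_graph_unique hy (emb_graph_mono hle hc)
  constructor
  · exact fun hy => ⟨rank_lt_of_vpair_mem_emb_graph hy, key y hy⟩
  · rintro ⟨hx, rfl⟩
    obtain ⟨y, hy⟩ := exists_vpair_mem_emb_graph (k := k) h hx
    rwa [← key y hy]

theorem exists_rank_lt {n : ℕ} (x : Fin n → VSet lam) : ∃ α < lam, ∀ i, (x i).1.rank < α := by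
  refine ⟨Finset.univ.sup fun i => (x i).1.rank + 1, ?_, fun i => ?_⟩
  · rw [Finset.sup_lt_iff hlam.out.bot_lt]
    exact fun i _ => add_one_lt_lam (rank_lt (x i))
  · exact (Order.lt_add_one_iff.2 le_rfl).trans_le
      (Finset.le_sup (f := fun i => (x i).1.rank + 1) (Finset.mem_univ i))

/-- The application of one embedding to another. -/
noncomputable def appl : Emb lam where
  toFun x := (exists_appl j k x).choose
  map_formula' n φ x := by
    obtain ⟨α, h, hx⟩ := exists_rank_lt x
    -- For the fixed formula `φ`, that `f` preserves `φ` is one first-order property of the set `f`,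
    -- which passes from `k ↾ V_α` to its image.
    refine (preserve₁ j (Q := fun f => ∀ x y : Fin n → VSet lam,
      (∀ i, (vpair (x i) (y i)).1 ∈ f.1) → (φ.Realize y ↔ φ.Realize x)) (.all_fin (.all_fin
        (.imp (.all_index fun i => .vpair_mem) (.iff (.realize φ _) (.realize φ _)))))
      (graph k α h)).2 ?_ x _ fun i => ?_
    · intro x y hxy
      have : y = k ∘ x := funext fun i => ((vpair_mem_graph k).1 (hxy i)).2
      rw [this]
      exact k.map_formula φ x
    · exact (vpair_mem_emb_graph_iff j k).2 ⟨(hx i).trans_le (le_ordMap j α), rfl⟩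

theorem vpair_mem_emb_graph {α : Ordinal.{u}} {h : α < lam} {x y : VSet lam} :
    (vpair x y).1 ∈ (j (graph k α h)).1 ↔ x.1.rank < ordMap j α ∧ y = appl j k x :=
  vpair_mem_emb_graph_iff j k

theorem emb_graph {α : Ordinal.{u}} (h : α < lam) :
    j (graph k α h) = graph (appl j k) (ordMap j α) (ordMap_lt j h) := by
  have hp := (preserve₁ j (Q := fun f => ∀ z : VSet lam, z.1 ∈ f.1 → ∃ x y, z = vpair x y)
    (.all (.imp .mem (.ex (.ex .eq_vpair)))) (graph k α h)).2 fun z hz => by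
      obtain ⟨x, -, e⟩ := (mem_graph k).1 hz
      exact ⟨x, _, Subtype.ext e⟩
  rw [VSet.eq_iff_forall_mem]
  intro z
  constructor
  · intro hz
    obtain ⟨x, y, rfl⟩ := hp z hz
    rwa [vpair_mem_graph, ← vpair_mem_emb_graph j k (h := h)]
  · intro hz
    obtain ⟨x, hx, e⟩ := (mem_graph _).1 hz
    rw [e, vpair_mem_emb_graph]
    exact ⟨hx, rfl⟩

theorem isApplication_appl : IsApplication j k (appl j k) := by
  intro x y
  constructor
  · rintro rfl
    have h := add_one_lt_lam (rank_lt x)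
    exact ⟨_, h, graph k _ h, graph_val k h, (vpair_mem_emb_graph j k).2
      ⟨(Order.lt_add_one_iff.2 le_rfl).trans_le (le_ordMap j _), rfl⟩⟩
  · rintro ⟨α, h, w, hw, hxy⟩
    obtain rfl : w = graph k α h := Subtype.ext (hw.trans (graph_val k h).symm)
    exact ((vpair_mem_emb_graph j k).1 hxy).2.symm

/-- Two embeddings agree if the first is the application `j k` and the second satisfies its
characteristic property at all ranks. -/
theorem appl_eq_of {l : Emb lam} (h : ∀ α, ∀ hα : α < lam, ∀ x y : VSet lam,
    (vpair x y).1 ∈ (j (graph k α hα)).1 → y = l x) : appl j k = l := by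
  ext x : 1
  have hx := add_one_lt_lam (rank_lt x)
  exact h _ hx x _ ((vpair_mem_emb_graph j k).2
    ⟨(Order.lt_add_one_iff.2 le_rfl).trans_le (le_ordMap j _), rfl⟩)

/-- Apply `j` to the membership of `(x, k x)` in the graph of `k`. -/
theorem appl_apply (x : VSet lam) : appl j k (j x) = j (k x) := by
  have hx := add_one_lt_lam (rank_lt x)
  have := (emb_vpair_mem j (r := graph k _ hx) (x := x) (y := k x)).2
    ((vpair_mem_graph k).2 ⟨Order.lt_add_one_iff.2 le_rfl, rfl⟩)
  exact ((vpair_mem_emb_graph j k).1 this).2.symm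

theorem comp_eq_appl_comp : j.comp k = (appl j k).comp j := by
  ext x : 1
  exact (appl_apply j k x).symm

/-- The image of `l ↾ V_α` under `k` is again a restriction, namely that of `k ◃ l` to `V_(k α)`;
then `j` is applied to it. -/
theorem appl_comp_left : appl (j.comp k) l = appl j (appl k l) := by
  refine appl_eq_of _ _ fun α hα x y hxy => ?_
  rw [FirstOrder.Language.ElementaryEmbedding.comp_apply, emb_graph k l] at hxy
  exact ((vpair_mem_emb_graph _ _).1 hxy).2

/-- Factorization of one graph through two others is first-order; the graph of `k` must be taken up
to `l α` to cover the values of `l` on `V_α`. -/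
theorem appl_comp_right : appl j (k.comp l) = (appl j k).comp (appl j l) := by
  refine appl_eq_of _ _ fun α hα x y hxy => ?_
  obtain ⟨z, hz, hzy⟩ := (preserve₃ j (Q := fun f g h => ∀ x y : VSet lam, (vpair x y).1 ∈ h.1 →
    ∃ z, (vpair x z).1 ∈ g.1 ∧ (vpair z y).1 ∈ f.1)
    (.all (.all (.imp .vpair_mem (.ex (.and .vpair_mem .vpair_mem)))))
    (graph k _ (ordMap_lt l hα)) (graph l α hα) (graph (k.comp l) α hα)).2 (fun x y hxy => by
      obtain ⟨hx, rfl⟩ := (vpair_mem_graph _).1 hxy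
      refine ⟨l x, (vpair_mem_graph _).2 ⟨hx, rfl⟩, (vpair_mem_graph _).2 ⟨?_, rfl⟩⟩
      rw [rank_emb]
      exact ordMap_strictMono l hx) x y hxy
  rw [((vpair_mem_emb_graph j k).1 hzy).2, ((vpair_mem_emb_graph j l).1 hz).2]
  rfl

/-- The identity of `V_λ`. -/
abbrev idEmb (lam : Ordinal.{u}) : Emb lam :=
  FirstOrder.Language.ElementaryEmbedding.refl setLanguage (VSet lam)

theorem appl_idEmb_left : appl (idEmb lam) k = k :=
  appl_eq_of _ _ fun _ hα _ _ hxy => ((vpair_mem_graph k (h := hα)).1 hxy).2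

theorem appl_idEmb_right : appl j (idEmb lam) = idEmb lam :=
  appl_eq_of _ _ fun α hα x y hxy =>
    (preserve₁ j (Q := fun f => ∀ x y : VSet lam, (vpair x y).1 ∈ f.1 → y = x)
      (.all (.all (.imp .vpair_mem .eq))) (graph (idEmb lam) α hα)).2
      (fun _ _ hxy => ((vpair_mem_graph _).1 hxy).2) x y hxy

/-- The monoid of elementary embeddings under composition. -/
abbrev embMonoid (lam : Ordinal.{u}) : Monoid (Emb lam) where
  mul j k := j.comp k
  one := idEmb lam
  mul_assoc _ _ _ := rfl
  one_mul _ := rfl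
  mul_one _ := rfl

theorem appl_self_distrib : appl j (appl k l) = appl (appl j k) (appl j l) := by
  rw [← appl_comp_left, comp_eq_appl_comp, appl_comp_left]

/-- The LD-system of elementary embeddings under application. -/
noncomputable abbrev embShelf (lam : Ordinal.{u}) [Fact (Order.IsSuccLimit lam)] :
    Shelf (Emb lam) where
  act := fun j k => appl j k
  self_distrib := @fun j k l => appl_self_distrib j k l

/-- The LD-monoid of elementary embeddings. -/
noncomputable abbrev embLDMonoid (lam : Ordinal.{u}) [Fact (Order.IsSuccLimit lam)] :
    LDMonoid (Emb lam) :=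
  { embMonoid lam, embShelf lam with
    mul_act := fun j k l => appl_comp_left j k l
    act_mul := fun j k l => appl_comp_right j k l
    mul_eq_act_mul := fun j k => comp_eq_appl_comp j k
    one_act := fun k => appl_idEmb_left k
    act_one := fun j => appl_idEmb_right j }

end OrdMap

attribute [local instance] embLDMonoid

/-! ### Critical points of embeddings -/

section CritAt

variable {lam : Ordinal.{u}} {j k : Emb lam} {α γ c : Ordinal.{u}}

/-- The ordinal `c` is the least one that is moved by `j`. -/
structure CritAt (j : Emb lam) (c : Ordinal.{u}) : Prop where
  fixes : Fixes j c
  lt_ordMap : c < ordMap j c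

theorem CritAt.fixes_iff (h : CritAt j c) : Fixes j γ ↔ γ ≤ c := by
  refine ⟨fun hγ => ?_, fun hγ => h.fixes.mono hγ⟩
  by_contra! hc
  exact h.lt_ordMap.ne' (hγ c hc)

theorem CritAt.lt (h : CritAt j c) : c < lam := by
  by_contra! hc
  exact h.lt_ordMap.ne' (ordMap_of_le j hc)

/-- Limit ordinals greater than zero, in the first-order language of set theory. -/
def IsLimitV (x : VSet lam) : Prop :=
  (∃ y : VSet lam, y.1 ∈ x.1) ∧
    ∀ y : VSet lam, y.1 ∈ x.1 → ∃ z : VSet lam, z.1 ∈ x.1 ∧ y.1 ∈ z.1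

theorem Dfn.isLimitV {a : ℕ} : Dfn (lam := lam) fun v => IsLimitV (v a) :=
  .and (.ex .mem) (.all (.imp .mem (.ex (.and .mem .mem))))

variable [hlam : Fact (Order.IsSuccLimit lam)]

theorem ordMap_one : ordMap (1 : Emb lam) α = α := by
  rcases lt_or_ge α lam with h | h
  · have := rank_emb (1 : Emb lam) (ordV α h)
    rw [rank_ordV] at this
    exact this.symm.trans (rank_ordV α h)
  · exact ordMap_of_le _ h

theorem ordMap_mul : ordMap (j * k) α = ordMap j (ordMap k α) := ordMap_comp j k α

theorem ordMap_act : ordMap (j ◃ k) (ordMap j α) = ordMap j (ordMap k α) := by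
  rw [← ordMap_mul, ← ordMap_mul, ← LDMonoid.mul_eq_act_mul]

theorem fixes_one : Fixes (1 : Emb lam) γ := fun _ _ => ordMap_one

theorem fixes_of_forall (h : ∀ x : VSet lam, x.1.rank < γ → j x = x) : Fixes j γ := by
  intro α hα
  rcases lt_or_ge α lam with hl | hl
  · have := rank_emb j (ordV α hl)
    rwa [h (ordV α hl) (by rwa [rank_ordV]), rank_ordV, eq_comm] at this
  · exact ordMap_of_le _ hl

theorem Fixes.eq_one (h : Fixes j lam) : j = 1 := by
  ext x : 1
  exact h.apply x (rank_lt x)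

/-- If `γ < λ`, then `k ↾ V_γ` is an identity function, and so is its image under `j`. Otherwise `k
= 1`. -/
theorem Fixes.act (h : Fixes k γ) (j : Emb lam) : Fixes (j ◃ k) (ordMap j γ) := by
  rcases lt_or_ge γ lam with hγ | hγ
  · have := (preserve₁ j (Q := fun f => ∀ x y : VSet lam, (vpair x y).1 ∈ f.1 → y = x)
      (.all (.all (.imp .vpair_mem .eq))) (graph k γ hγ)).2 (fun x y hxy => by
        obtain ⟨hx, rfl⟩ := (vpair_mem_graph k).1 hxy
        exact h.apply x hx)
    exact fixes_of_forall fun x hx => this _ _ ((vpair_mem_emb_graph j k).2 ⟨hx, rfl⟩)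
  · rw [(h.mono hγ).eq_one, LDMonoid.act_one]
    exact fixes_one

theorem Fixes.mul (h : Fixes j γ) (h' : Fixes k γ) : Fixes (j * k) γ := fun α hα => by
  rw [ordMap_mul, h' α hα, h α hα]

theorem exists_critAt (h : ¬ Fixes j γ) : ∃ c < γ, CritAt j c := by
  simp only [Fixes, not_forall] at h
  obtain ⟨α, ⟨hα, hne⟩, hmin⟩ :=
    WellFounded.has_min (wellFounded_lt (α := Ordinal.{u})) {α | ∃ _ : α < γ, ordMap j α ≠ α}
      ⟨h.choose, h.choose_spec⟩
  refine ⟨α, hα, fun β hβ => ?_, lt_of_le_of_ne (le_ordMap j α) hne.symm⟩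
  by_contra hβ'
  exact hmin β ⟨hβ.trans hα, hβ'⟩ hβ

/-- The point `j c` is moved because `(j ◃ k) (j c) = j (k c) > j c`. -/
theorem CritAt.act (h : CritAt k c) (j : Emb lam) : CritAt (j ◃ k) (ordMap j c) :=
  ⟨h.fixes.act j, by rw [ordMap_act]; exact ordMap_strictMono j h.lt_ordMap⟩

theorem IsCrit.critAt (h : IsCrit j c) : CritAt j c := by
  have hf : Fixes j c := fun α hα => by
    have := rank_emb j (ordV α (hα.trans h.lt))
    rwa [h.apply_eq hα, rank_ordV, eq_comm] at this
  refine ⟨hf, lt_of_le_of_ne (le_ordMap j c) fun hc => h.apply_ne ?_⟩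
  have : Fixes j (c + 1) := fun α hα => by
    rcases (Order.lt_add_one_iff.1 hα).lt_or_eq with h' | rfl
    · exact hf α h'
    · exact hc.symm
  exact this.apply _ (by rw [rank_ordV]; exact Order.lt_add_one_iff.2 le_rfl)

theorem CritAt.isSuccLimit (h : CritAt j c) : Order.IsSuccLimit c := by
  refine ⟨fun hc => ?_, fun α hα => ?_⟩
  · have := h.lt_ordMap
    rw [hc.eq_bot, Ordinal.bot_eq_zero, ordMap_zero] at this
    exact this.false
  · have := h.lt_ordMap
    rw [← Order.succ_eq_of_covBy hα, Order.succ_eq_add_one,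
      ordMap_add_one j (hα.lt.trans h.lt), h.fixes α hα.lt] at this
    exact this.false

theorem isLimitV_ordV (h : α < lam) : IsLimitV (ordV α h) ↔ Order.IsSuccLimit α := by
  constructor
  · rintro ⟨⟨y, hy⟩, hz⟩
    obtain ⟨β, hβ, -⟩ := Ordinal.mem_toZFSet_iff.1 hy
    refine ⟨fun hα => (hα.eq_bot ▸ hβ).not_ge bot_le, fun β hβ => ?_⟩
    obtain ⟨z, hz, hz'⟩ := hz (ordV β (hβ.lt.trans h)) (Ordinal.toZFSet_mem_toZFSet_iff.2 hβ.lt)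
    obtain ⟨δ, hδ, e⟩ := Ordinal.mem_toZFSet_iff.1 hz
    rw [← e] at hz'
    exact hβ.2 (Ordinal.toZFSet_mem_toZFSet_iff.1 hz') hδ
  · intro hα
    refine ⟨⟨ordV 0 hlam.out.bot_lt, Ordinal.toZFSet_mem_toZFSet_iff.2 hα.bot_lt⟩, ?_⟩
    intro y hy
    obtain ⟨β, hβ, e⟩ := Ordinal.mem_toZFSet_iff.1 hy
    have hβ' := hα.succ_lt hβ
    refine ⟨ordV _ (hβ'.trans h), Ordinal.toZFSet_mem_toZFSet_iff.2 hβ', ?_⟩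
    rw [← e]
    exact Ordinal.toZFSet_mem_toZFSet_iff.2 (Order.lt_succ β)

/-- The critical point is a limit. Were it `ω`, then `j ω` would contain no limit, like `ω`, and yet
contain `ω`. -/
theorem CritAt.omega0_lt (h : CritAt j c) : Ordinal.omega0 < c := by
  refine lt_of_le_of_ne (Ordinal.omega0_le_of_isSuccLimit h.isSuccLimit) ?_
  rintro rfl
  have hd : Dfn (lam := lam) fun v => ∀ y : VSet lam, y.1 ∈ (v 0).1 → ¬ IsLimitV y :=
    .all (.imp .mem (.not .isLimitV))
  have := (preserve₁ j (Q := fun x => ∀ y : VSet lam, y.1 ∈ x.1 → ¬ IsLimitV y) hd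
    (ordV _ h.lt)).2 (fun y hy hy' => by
      obtain ⟨β, hβ, e⟩ := Ordinal.mem_toZFSet_iff.1 hy
      obtain rfl : ordV β (hβ.trans h.lt) = y := Subtype.ext e
      exact (Ordinal.omega0_le_of_isSuccLimit ((isLimitV_ordV _).1 hy')).not_gt hβ)
    (ordV _ h.lt)
  refine this ?_ ((isLimitV_ordV _).2 h.isSuccLimit)
  have ho : (j (ordV _ h.lt)).1.IsOrdinal := (emb_isOrdinal j).2 (ZFSet.isOrdinal_toZFSet _)
  rw [← ho.toZFSet_rank_eq, rank_emb, rank_ordV]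
  exact Ordinal.toZFSet_mem_toZFSet_iff.2 h.lt_ordMap

end CritAt

/-! ### Functions on sequences that are onto on all large sets -/

section Jonsson

open Cardinal

/-- Transfinite recursion along a well-order of `I` of least type: fewer than `#I` values have been
used before any stage, so `A i` still has a fresh element. -/
theorem exists_injective_mem {I S : Type v} (A : I → Set S) (hA : ∀ i, #I ≤ #(A i)) :
    ∃ t : I → S, Function.Injective t ∧ ∀ i, t i ∈ A i := by
  obtain ⟨_, _, hr⟩ := Cardinal.exists_ord_eq_type_lt I
  have hex : ∀ (i : I) (f : Set.Iio i → S), ∃ s ∈ A i, s ∉ Set.range f := by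
    intro i f
    by_contra! h
    have h₁ : #(A i) ≤ #(Set.range f) := Cardinal.mk_le_mk_of_subset h
    have h₂ : #(Set.Iio i) < #I := Cardinal.mk_Iio_lt i hr
    exact ((hA i).trans (h₁.trans Cardinal.mk_range_le)).not_gt h₂
  let t : I → S := wellFounded_lt.fix fun i f => (hex i fun k => f k.1 k.2).choose
  have ht : ∀ i, t i = (hex i fun k => t k.1).choose := fun i => wellFounded_lt.fix_eq _ i
  have ht₁ : ∀ i, t i ∈ A i := fun i => by
    rw [ht]; exact (hex i fun k => t k.1).choose_spec.1
  have ht₂ : ∀ i k, k < i → t k ≠ t i := fun i k hk e => by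
    have := (hex i fun k => t k.1).choose_spec.2
    rw [← ht] at this
    exact this ⟨⟨k, hk⟩, e⟩
  refine ⟨t, fun i k e => ?_, ht₁⟩
  rcases lt_trichotomy i k with h | h | h
  · exact absurd e (ht₂ k i h)
  · exact h
  · exact absurd e.symm (ht₂ i k h)

/-- For each pair `(g, y)` there are at least as many sequences `g ∘ s` as there are pairs, so
distinct sequences can be reserved for distinct pairs; `F` sends the one reserved for `(g, y)` to
`y`. This takes the place of an `ω`-Jónsson function. -/
theorem exists_forall_injective_exists_apply_eq {T : Type v} [Nonempty T]
    (hT : #((T → T) × T) ≤ #(ℕ → T)) :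
    ∃ F : (ℕ → T) → T, ∀ g : T → T, Function.Injective g → ∀ y, ∃ s : ℕ → T, F (g ∘ s) = y := by
  let I := {g : T → T // Function.Injective g} × T
  have hI : #I ≤ #(ℕ → T) := by
    refine le_trans ?_ hT
    exact Cardinal.mk_le_of_injective (f := fun i : I => (i.1.1, i.2)) fun i k e => by
      rw [Prod.mk.injEq] at e
      exact Prod.ext (Subtype.ext e.1) e.2
  obtain ⟨t, ht, hmem⟩ := exists_injective_mem (I := I)
    (fun i => Set.range fun s : ℕ → T => i.1.1 ∘ s) fun i => by
      rw [Cardinal.mk_range_eq _ i.1.2.comp_left]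
      exact hI
  refine ⟨fun s => Function.extend t (fun i => i.2) (fun _ => Classical.arbitrary T) s,
    fun g hg y => ?_⟩
  obtain ⟨s, hs⟩ := hmem (⟨g, hg⟩, y)
  refine ⟨s, ?_⟩
  have hs' : g ∘ s = t (⟨g, hg⟩, y) := hs
  change Function.extend t _ _ (g ∘ s) = y
  rw [hs', ht.extend_apply]

end Jonsson

/-! ### Sequences of elements of `V_λ`, and Kunen's theorem -/

section Kunen

variable {lam : Ordinal.{u}} [hlam : Fact (Order.IsSuccLimit lam)]

theorem natCast_lt_lam (n : ℕ) : (n : Ordinal.{u}) < lam :=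
  (Ordinal.natCast_lt_omega0 n).trans_le (Ordinal.omega0_le_of_isSuccLimit hlam.out)

/-- The natural number `n` as an element of `V_λ`. -/
noncomputable def natV (lam : Ordinal.{u}) [Fact (Order.IsSuccLimit lam)] (n : ℕ) : VSet lam :=
  ordV n (natCast_lt_lam n)

theorem natV_inj {m n : ℕ} (h : natV lam m = natV lam n) : m = n := by
  have := Ordinal.toZFSet_injective (congrArg Subtype.val h)
  exact_mod_cast this

theorem mem_ordV_omega0 {h : Ordinal.omega0 < lam} {x : VSet lam} :
    x.1 ∈ (ordV _ h).1 ↔ ∃ n, x = natV lam n := by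
  rw [ordV, Ordinal.mem_toZFSet_iff]
  constructor
  · rintro ⟨α, hα, e⟩
    obtain ⟨n, rfl⟩ := Ordinal.lt_omega0.1 hα
    exact ⟨n, Subtype.ext e.symm⟩
  · rintro ⟨n, rfl⟩
    exact ⟨n, Ordinal.natCast_lt_omega0 n, rfl⟩

/-- The element `t` of `V_λ` is the sequence `s`. -/
def IsSeq (t : VSet lam) (s : ℕ → VSet lam) : Prop :=
  ∀ z : VSet lam, z.1 ∈ t.1 ↔ ∃ n, z = vpair (natV lam n) (s n)

theorem exists_isSeq {s : ℕ → VSet lam} {β : Ordinal.{u}} (hβ : β < lam)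
    (hω : Ordinal.omega0 < lam) (hs : ∀ n, (s n).1.rank < β) : ∃ t, IsSeq t s := by
  refine ⟨relSet (max β Ordinal.omega0) (max_lt hβ hω) fun x y => ∃ n, x = natV lam n ∧ y = s n,
    fun z => ?_⟩
  rw [mem_relSet]
  constructor
  · rintro ⟨_, _, h, -, -, n, rfl, rfl⟩
    exact ⟨n, Subtype.ext h⟩
  · rintro ⟨n, rfl⟩
    refine ⟨_, _, rfl, lt_max_of_lt_right ?_, lt_max_of_lt_left (hs n), n, rfl, rfl⟩
    rw [natV, rank_ordV]
    exact Ordinal.natCast_lt_omega0 n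

theorem IsSeq.vpair_mem {t : VSet lam} {s : ℕ → VSet lam} (h : IsSeq t s) {x y : VSet lam} :
    (vpair x y).1 ∈ t.1 ↔ ∃ n, x = natV lam n ∧ y = s n := by
  simp only [h (vpair x y), vpair_inj]

theorem IsSeq.natV_mem {t : VSet lam} {s : ℕ → VSet lam} (h : IsSeq t s) {n : ℕ} {y : VSet lam} :
    (vpair (natV lam n) y).1 ∈ t.1 ↔ y = s n := by
  rw [h.vpair_mem]
  constructor
  · rintro ⟨m, e, rfl⟩
    rw [natV_inj e]
  · exact fun e => ⟨n, rfl, e⟩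

theorem IsSeq.seq_eq {t : VSet lam} {s s' : ℕ → VSet lam} (h : IsSeq t s) (h' : IsSeq t s') :
    s = s' :=
  funext fun _ => h'.natV_mem.1 (h.natV_mem.2 rfl)

theorem IsSeq.set_eq {t t' : VSet lam} {s : ℕ → VSet lam} (h : IsSeq t s) (h' : IsSeq t' s) :
    t = t' := by
  rw [VSet.eq_iff_forall_mem]
  exact fun z => (h z).trans (h' z).symm

theorem IsSeq.rank_le {t : VSet lam} {s : ℕ → VSet lam} (h : IsSeq t s) {δ : Ordinal.{u}}
    (hδ : Order.IsSuccLimit δ) (hs : ∀ n, (s n).1.rank < δ) : t.1.rank ≤ δ := by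
  refine ZFSet.rank_le_iff.2 fun z hz => ?_
  obtain ⟨n, e⟩ := (h ⟨z, mem_of_mem hz⟩).1 hz
  rw [Subtype.ext_iff] at e
  rw [show z = (vpair (natV lam n) (s n)).1 from e]
  refine ZFSet.mem_vonNeumann.1 (pair_mem_vonNeumann hδ ?_ (ZFSet.mem_vonNeumann.2 (hs n)))
  rw [ZFSet.mem_vonNeumann, natV, rank_ordV]
  exact (Ordinal.natCast_lt_omega0 n).trans_le (Ordinal.omega0_le_of_isSuccLimit hδ)

/-- The first-order characterization of functions with domain `w`. -/
def IsFunOn (w t : VSet lam) : Prop :=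
  (∀ z : VSet lam, z.1 ∈ t.1 → ∃ n : VSet lam, n.1 ∈ w.1 ∧ ∃ x, z = vpair n x) ∧
  (∀ n : VSet lam, n.1 ∈ w.1 → ∃ x, (vpair n x).1 ∈ t.1) ∧
  ∀ n x y : VSet lam, (vpair n x).1 ∈ t.1 → (vpair n y).1 ∈ t.1 → x = y

theorem Dfn.isFunOn {a b : ℕ} : Dfn (lam := lam) fun v => IsFunOn (v a) (v b) :=
  .and (.all (.imp .mem (.ex (.and .mem (.ex .eq_vpair)))))
    (.and (.all (.imp .mem (.ex .vpair_mem)))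
      (.all (.all (.all (.imp .vpair_mem (.imp .vpair_mem .eq))))))

theorem isFunOn_omega0_iff {h : Ordinal.omega0 < lam} {t : VSet lam} :
    IsFunOn (ordV _ h) t ↔ ∃ s, IsSeq t s := by
  constructor
  · rintro ⟨h₁, h₂, h₃⟩
    choose s hs using fun n : ℕ => h₂ (natV lam n) (mem_ordV_omega0.2 ⟨n, rfl⟩)
    refine ⟨s, fun z => ⟨fun hz => ?_, ?_⟩⟩
    · obtain ⟨n, hn, x, rfl⟩ := h₁ z hz
      obtain ⟨n, rfl⟩ := mem_ordV_omega0.1 hn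
      exact ⟨n, by rw [h₃ _ _ _ hz (hs n)]⟩
    · rintro ⟨n, rfl⟩
      exact hs n
  · rintro ⟨s, hs⟩
    refine ⟨fun z hz => ?_, fun n hn => ?_, fun n x y hx hy => ?_⟩
    · obtain ⟨n, rfl⟩ := (hs z).1 hz
      exact ⟨_, mem_ordV_omega0.2 ⟨n, rfl⟩, _, rfl⟩
    · obtain ⟨n, rfl⟩ := mem_ordV_omega0.1 hn
      exact ⟨_, hs.natV_mem.2 rfl⟩
    · obtain ⟨n, rfl, rfl⟩ := hs.vpair_mem.1 hx
      exact (hs.natV_mem.1 hy).symm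

variable {j : Emb lam} {c : Ordinal.{u}}

theorem CritAt.apply_omega0 (h : CritAt j c) (hω : Ordinal.omega0 < lam) :
    j (ordV _ hω) = ordV _ hω :=
  h.fixes.apply _ (by rw [rank_ordV]; exact h.omega0_lt)

theorem CritAt.apply_natV (h : CritAt j c) (n : ℕ) : j (natV lam n) = natV lam n :=
  h.fixes.apply _ (by
    rw [natV, rank_ordV]
    exact (Ordinal.natCast_lt_omega0 n).trans h.omega0_lt)

/-- Since `ω` and all natural numbers are fixed, `j` acts on a sequence termwise. -/
theorem IsSeq.emb {t : VSet lam} {s : ℕ → VSet lam} (h : IsSeq t s) (hj : CritAt j c) :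
    IsSeq (j t) (j ∘ s) := by
  have hω := hj.omega0_lt.trans hj.lt
  obtain ⟨s', hs'⟩ := isFunOn_omega0_iff.1 ((hj.apply_omega0 hω) ▸
    (preserve₂ j (Q := fun w t => IsFunOn w t) .isFunOn (ordV _ hω) t).2
      (isFunOn_omega0_iff.2 ⟨s, h⟩))
  convert hs'
  funext n
  refine hs'.natV_mem.1 ?_
  rw [← hj.apply_natV n]
  exact (emb_vpair_mem j).2 (h.natV_mem.2 rfl)

/-- The first-order statement that `f` is a function from the sequences `w → d` to `d` that maps
the sequences in the range of any injective map `g : d → d` onto `d`. -/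
def IsJonsson (d w f : VSet lam) : Prop :=
  (∀ t y y' : VSet lam, (vpair t y).1 ∈ f.1 → (vpair t y').1 ∈ f.1 → y = y') ∧
  (∀ s : VSet lam, IsFunOn w s → (∀ n x : VSet lam, (vpair n x).1 ∈ s.1 → x.1 ∈ d.1) →
    ∃ y, (vpair s y).1 ∈ f.1 ∧ y.1 ∈ d.1) ∧
  ∀ g : VSet lam, (∀ x : VSet lam, x.1 ∈ d.1 → ∃ y : VSet lam, y.1 ∈ d.1 ∧ (vpair x y).1 ∈ g.1) →
    (∀ x y z : VSet lam, (vpair x y).1 ∈ g.1 → (vpair x z).1 ∈ g.1 → y = z) →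
    (∀ x y z : VSet lam, (vpair x z).1 ∈ g.1 → (vpair y z).1 ∈ g.1 → x = y) →
    ∀ y : VSet lam, y.1 ∈ d.1 → ∃ s t : VSet lam, IsFunOn w s ∧ IsFunOn w t ∧
      (∀ n x : VSet lam, (vpair n x).1 ∈ s.1 → x.1 ∈ d.1) ∧
      (∀ n x z : VSet lam, (vpair n x).1 ∈ s.1 → (vpair x z).1 ∈ g.1 → (vpair n z).1 ∈ t.1) ∧
      (vpair t y).1 ∈ f.1

theorem Dfn.isJonsson {a b c : ℕ} :
    Dfn (lam := lam) fun v => IsJonsson (v a) (v b) (v c) :=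
  .and (.all (.all (.all (.imp .vpair_mem (.imp .vpair_mem .eq)))))
    (.and (.all (.imp .isFunOn (.imp (.all (.all (.imp .vpair_mem .mem)))
      (.ex (.and .vpair_mem .mem)))))
    (.all (.imp (.all (.imp .mem (.ex (.and .mem .vpair_mem))))
      (.imp (.all (.all (.all (.imp .vpair_mem (.imp .vpair_mem .eq)))))
      (.imp (.all (.all (.all (.imp .vpair_mem (.imp .vpair_mem .eq)))))
      (.all (.imp .mem (.ex (.ex (.and .isFunOn (.and .isFunOn
        (.and (.all (.all (.imp .vpair_mem .mem)))
        (.and (.all (.all (.all (.imp .vpair_mem (.imp .vpair_mem .vpair_mem)))))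
          .vpair_mem)))))))))))))

open Cardinal in
-- Countable cofinality is used here: `(g, y)` is coded by `y` followed by the pieces of the graph
-- of `g` inside the `V_(d n)`, each of which has rank below `δ`.
theorem mk_prod_le_mk_seq {δ : Ordinal.{u}} (hδ : Order.IsSuccLimit δ) {d : ℕ → Ordinal.{u}}
    (hd : ∀ n, d n < δ) (hcof : ∀ α < δ, ∃ n, α < d n) (hlt : δ < lam) :
    #(({x : VSet lam // x.1.rank < δ} → {x : VSet lam // x.1.rank < δ}) ×
      {x : VSet lam // x.1.rank < δ}) ≤ #(ℕ → {x : VSet lam // x.1.rank < δ}) := by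
  let T := {x : VSet lam // x.1.rank < δ}
  have hlev : ∀ (g : T → T) n,
      (ZFSet.sep (fun z => ∃ a : T, z = (vpair a.1 (g a).1).1) (V_ (d n))).rank < δ :=
    fun g n => lt_of_le_of_lt ((ZFSet.rank_mono ZFSet.sep_subset).trans
      (ZFSet.rank_vonNeumann _).le) (hd n)
  let code : (T → T) × T → ℕ → T := fun p n => Nat.casesOn (motive := fun _ => T) n p.2 fun n =>
    ⟨⟨ZFSet.sep (fun z => ∃ a : T, z = (vpair a.1 (p.1 a).1).1) (V_ (d n)),
      ZFSet.mem_vonNeumann.2 ((hlev p.1 n).trans hlt)⟩, hlev p.1 n⟩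
  refine Cardinal.mk_le_of_injective (f := code) ?_
  rintro ⟨g, y⟩ ⟨g', y'⟩ e
  refine Prod.ext (funext fun a => ?_) (congrFun e 0)
  obtain ⟨n, hn⟩ := hcof (vpair a.1 (g a).1).1.rank (ZFSet.mem_vonNeumann.1
    (pair_mem_vonNeumann hδ (ZFSet.mem_vonNeumann.2 a.2) (ZFSet.mem_vonNeumann.2 (g a).2)))
  have hcode : ∀ (p : (T → T) × T) (z : ZFSet.{u}), z ∈ (code p (n + 1)).1.1 ↔
      z ∈ V_ (d n) ∧ ∃ a : T, z = (vpair a.1 (p.1 a).1).1 := fun p z => by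
    change z ∈ ZFSet.sep (fun z => ∃ a : T, z = (vpair a.1 (p.1 a).1).1) (V_ (d n)) ↔ _
    rw [ZFSet.mem_sep]
  have h₁ := (hcode (g, y) (vpair a.1 (g a).1).1).2 ⟨ZFSet.mem_vonNeumann.2 hn, a, rfl⟩
  rw [e] at h₁
  obtain ⟨-, a', h₂⟩ := (hcode _ _).1 h₁
  obtain ⟨h₃, h₄⟩ := vpair_inj.1 (Subtype.ext h₂)
  obtain rfl : a = a' := Subtype.ext h₃
  exact Subtype.ext h₄

theorem exists_isJonsson {δ : Ordinal.{u}} (hδ : Order.IsSuccLimit δ) {d : ℕ → Ordinal.{u}}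
    (hd : ∀ n, d n < δ) (hcof : ∀ α < δ, ∃ n, α < d n) (hlt : δ < lam)
    (hω : Ordinal.omega0 < lam) : ∃ f, IsJonsson (levV δ hlt) (ordV _ hω) f := by
  let T := {x : VSet lam // x.1.rank < δ}
  have : Nonempty T := ⟨⟨ordV 0 hlam.out.bot_lt, by rw [rank_ordV]; exact hδ.bot_lt⟩⟩
  obtain ⟨F, hF⟩ := exists_forall_injective_exists_apply_eq (T := T)
    (mk_prod_le_mk_seq hδ hd hcof hlt)
  obtain ⟨f, hmem⟩ : ∃ f : VSet lam, ∀ t y : VSet lam, (vpair t y).1 ∈ f.1 ↔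
      ∃ s : ℕ → T, IsSeq t (fun n => (s n).1) ∧ y = (F s).1 := by
    -- A sequence in `V_δ` may have rank exactly `δ`, hence the bound `δ + 1`.
    refine ⟨relSet (δ + 1) (add_one_lt_lam hlt) fun t y =>
      ∃ s : ℕ → T, IsSeq t (fun n => (s n).1) ∧ y = (F s).1, fun t y => ?_⟩
    rw [vpair_mem_relSet]
    refine ⟨fun h => h.2.2, fun h => ⟨?_, ?_, h⟩⟩
    · obtain ⟨s, hs, -⟩ := h
      exact Order.lt_add_one_iff.2 (hs.rank_le hδ fun n => (s n).2)
    · obtain ⟨s, -, rfl⟩ := h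
      exact (F s).2.trans (Order.lt_add_one_iff.2 le_rfl)
  refine ⟨f, fun t y y' hy hy' => ?_, fun s hs hsd => ?_, fun g hg hfun hinj y hy => ?_⟩
  · obtain ⟨s, hs, rfl⟩ := (hmem t y).1 hy
    obtain ⟨s', hs', rfl⟩ := (hmem t y').1 hy'
    have : s = s' := funext fun n => Subtype.ext (congrFun (hs.seq_eq hs') n)
    rw [this]
  · obtain ⟨s', hs'⟩ := isFunOn_omega0_iff.1 hs
    have hr : ∀ n, (s' n).1.rank < δ := fun n => mem_levV.1 (hsd _ _ (hs'.natV_mem.2 rfl))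
    exact ⟨_, (hmem _ _).2 ⟨fun n => ⟨s' n, hr n⟩, hs', rfl⟩, mem_levV.2 (F _).2⟩
  · choose G hGd hG using fun x : T => hg x.1 (mem_levV.2 x.2)
    let G' : T → T := fun x => ⟨G x, mem_levV.1 (hGd x)⟩
    have hG' : Function.Injective G' := fun x x' e => by
      have := congrArg Subtype.val e
      refine Subtype.ext (hinj _ _ _ (hG x) ?_)
      rw [show G x = G x' from this]
      exact hG x'
    obtain ⟨s, hs⟩ := hF G' hG' ⟨y, mem_levV.1 hy⟩
    obtain ⟨S, hS⟩ := exists_isSeq (s := fun n => (s n).1) hlt hω fun n => (s n).2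
    obtain ⟨t, ht⟩ := exists_isSeq (s := fun n => (G' (s n)).1) hlt hω fun n => (G' (s n)).2
    refine ⟨S, t, isFunOn_omega0_iff.2 ⟨_, hS⟩, isFunOn_omega0_iff.2 ⟨_, ht⟩, ?_, ?_, ?_⟩
    · intro n x hx
      obtain ⟨n, rfl, rfl⟩ := hS.vpair_mem.1 hx
      exact mem_levV.2 (s n).2
    · intro n x z hx hz
      obtain ⟨n, rfl, rfl⟩ := hS.vpair_mem.1 hx
      exact ht.natV_mem.2 (hfun _ _ _ hz (hG (s n)))
    · exact (hmem _ _).2 ⟨G' ∘ s, ht, by rw [hs]⟩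

/-- Ranks below `c` are fixed, and all others are sent above `c`. -/
theorem CritAt.apply_ne_ordV (h : CritAt j c) (y : VSet lam) : j y ≠ ordV c h.lt := by
  intro e
  have hr := rank_emb j y
  rw [e, rank_ordV] at hr
  rcases lt_or_ge y.1.rank c with hy | hy
  · rw [h.fixes _ hy] at hr
    exact hy.ne' hr
  · exact (h.lt_ordMap.trans_le ((ordMap_strictMono j).monotone hy)).ne hr

/-- Kunen's argument: no ordinal `δ < λ` of countable cofinality above the critical point is
fixed. -/
theorem CritAt.ordMap_ne_self (h : CritAt j c) {δ : Ordinal.{u}} (hδ : Order.IsSuccLimit δ)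
    {d : ℕ → Ordinal.{u}} (hd : ∀ n, d n < δ) (hcof : ∀ α < δ, ∃ n, α < d n) (hlt : δ < lam)
    (hc : c < δ) : ordMap j δ ≠ δ := by
  intro hfix
  have hω := h.omega0_lt.trans h.lt
  obtain ⟨f, hf⟩ := exists_isJonsson hδ hd hcof hlt hω
  have hD : j (levV δ hlt) = levV δ hlt := by
    rw [emb_levV]
    exact Subtype.ext (congrArg ZFSet.vonNeumann hfix)
  have hf' := (preserve₃ j (Q := fun d w f => IsJonsson d w f) .isJonsson (levV δ hlt)
    (ordV _ hω) f).2 hf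
  rw [hD, h.apply_omega0] at hf'
  -- The image of `f` is again such a function on `V_δ`. It is used for the injection `j ↾ V_δ`, an
  -- element of `V_λ` as `δ < λ`, and the target value `c`.
  obtain ⟨s, t, hs, ht, hsd, hst, hy⟩ := hf'.2.2 (graph j δ hlt)
    (fun x hx => ⟨j x, by
      rw [mem_levV, rank_emb, ← hfix]
      exact ordMap_strictMono j (mem_levV.1 hx), (vpair_mem_graph j).2 ⟨mem_levV.1 hx, rfl⟩⟩)
    (fun x y z hy hz => by
      rw [((vpair_mem_graph j).1 hy).2, ((vpair_mem_graph j).1 hz).2])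
    (fun x y z hy hz => j.injective
      (((vpair_mem_graph j).1 hy).2.symm.trans ((vpair_mem_graph j).1 hz).2))
    (ordV c h.lt) (mem_levV.2 (by rwa [rank_ordV]))
  obtain ⟨σ, hσ⟩ := isFunOn_omega0_iff.1 hs
  obtain ⟨τ, hτ⟩ := isFunOn_omega0_iff.1 ht
  have hστ : j ∘ σ = τ := funext fun n => hτ.natV_mem.1 (hst _ (σ n) _ (hσ.natV_mem.2 rfl)
    ((vpair_mem_graph j).2 ⟨mem_levV.1 (hsd _ _ (hσ.natV_mem.2 rfl)), rfl⟩))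
  have hjs : j s = t := (hσ.emb h).set_eq (hστ ▸ hτ)
  obtain ⟨y, hy', -⟩ := hf.2.1 s hs hsd
  -- With `t = j s`, the value `c` of `j f` at `t` is `j (f s)`, so `c` would be in the range of
  -- `j`.
  refine h.apply_ne_ordV y (hf'.1 t _ _ ?_ hy)
  rw [← hjs]
  exact (emb_vpair_mem j).2 hy'

theorem CritAt.lt_iterate_succ (h : CritAt j c) (n : ℕ) :
    (ordMap j)^[n] c < (ordMap j)^[n + 1] c := by
  rw [Function.iterate_succ_apply]
  exact ((ordMap_strictMono j).iterate n) h.lt_ordMap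

/-- Otherwise the supremum `δ` of the critical sequence is below `λ`. As `j` only shifts this
sequence, whose image must be cofinal in `j δ`, it fixes `δ`, against `CritAt.ordMap_ne_self`. -/
theorem CritAt.exists_lt_iterate (h : CritAt j c) {α : Ordinal.{u}} (hα : α < lam) :
    ∃ n, α < (ordMap j)^[n] c := by
  by_contra! hle
  have hbdd : BddAbove (Set.range fun n => (ordMap j)^[n] c) := ⟨α, by
    rintro _ ⟨n, rfl⟩
    exact hle n⟩
  obtain ⟨δ, hδ⟩ : ∃ δ, δ = ⨆ n, (ordMap j)^[n] c := ⟨_, rfl⟩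
  have hlt : δ < lam := by
    rw [hδ]
    exact (ciSup_le hle).trans_lt hα
  have hd : ∀ n, (ordMap j)^[n] c < δ := fun n => by
    rw [hδ]
    exact (h.lt_iterate_succ n).trans_le (le_ciSup hbdd (n + 1))
  have hcof : ∀ β < δ, ∃ n, β < (ordMap j)^[n] c := fun β hβ => by
    rw [hδ] at hβ
    exact exists_lt_of_lt_ciSup hβ
  have hlim : Order.IsSuccLimit δ := by
    refine ⟨fun hm => (hm.eq_bot ▸ hd 0).not_ge bot_le, fun β hβ => ?_⟩
    obtain ⟨n, hn⟩ := hcof β hβ.lt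
    exact hβ.2 hn (hd n)
  refine h.ordMap_ne_self hlim hd hcof hlt (hd 0) (le_antisymm ?_ (le_ordMap j δ))
  obtain ⟨t, ht⟩ := exists_isSeq
    (s := fun n => ordV ((ordMap j)^[n] c) ((hd n).trans hlt)) hlt
    (h.omega0_lt.trans h.lt) fun n => by rw [rank_ordV]; exact hd n
  have hpres := (preserve₂ j (Q := fun d t => ∀ x : VSet lam, x.1.rank < d.1.rank →
    ∃ n y, (vpair n y).1 ∈ t.1 ∧ x.1.rank < y.1.rank)
    (.all (.imp .rank_lt (.ex (.ex (.and .vpair_mem .rank_lt))))) (ordV δ hlt) t).2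
    fun x hx => by
      rw [rank_ordV] at hx
      obtain ⟨n, hn⟩ := hcof _ hx
      exact ⟨_, _, ht.natV_mem.2 rfl, by rwa [rank_ordV]⟩
  by_contra! hδ'
  obtain ⟨n, y, hy, hlt'⟩ := hpres (ordV δ hlt) (by rwa [rank_emb, rank_ordV])
  obtain ⟨n, -, rfl⟩ := (ht.emb h).vpair_mem.1 hy
  rw [Function.comp_apply, rank_emb, rank_ordV, rank_ordV,
    ← Function.iterate_succ_apply' (ordMap j)] at hlt'
  exact (hd (n + 1)).not_gt hlt'

end Kunen

/-! ### The relations `≡^γ` -/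

section RankEquiv

variable {lam : Ordinal.{u}}

theorem rankEquiv_iff {γ : Ordinal.{u}} {j k : Emb lam} : rankEquiv lam γ j k ↔
    ∀ x y : VSet lam, x.1.rank < γ → y.1.rank < γ → (y.1 ∈ (j x).1 ↔ y.1 ∈ (k x).1) := by
  constructor
  · intro h x y hx hy
    have := ZFSet.ext_iff.1 (h x (ZFSet.mem_vonNeumann.2 hx)) y.1
    simpa [ZFSet.mem_vonNeumann, hy] using this
  · intro h x hx
    ext y
    simp only [ZFSet.mem_inter, ZFSet.mem_vonNeumann]
    refine and_congr_left fun hy => ⟨fun hj => ?_, fun hk => ?_⟩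
    · exact (h x ⟨y, mem_of_mem hj⟩ (ZFSet.mem_vonNeumann.1 hx) hy).1 hj
    · exact (h x ⟨y, mem_of_mem hk⟩ (ZFSet.mem_vonNeumann.1 hx) hy).2 hk

variable [hlam : Fact (Order.IsSuccLimit lam)] {j j' k k' r : Emb lam} {α β γ c : Ordinal.{u}}

theorem lt_ordMap_iff_of_rankEquiv (h : rankEquiv lam γ j k) (hγ : γ ≤ lam) (hα : α < γ)
    (hβ : β < γ) : β < ordMap j α ↔ β < ordMap k α := by
  have := rankEquiv_iff.1 h (levV α (hα.trans_le hγ)) (ordV β (hβ.trans_le hγ))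
    (by rwa [levV, ZFSet.rank_vonNeumann]) (by rwa [rank_ordV])
  rwa [emb_levV, emb_levV, mem_levV, mem_levV, rank_ordV] at this

theorem ordMap_eq_of_rankEquiv (h : rankEquiv lam γ j k) (hγ : γ ≤ lam) (hα : α < γ)
    (hj : ordMap j α < γ) : ordMap k α = ordMap j α := by
  apply le_antisymm
  · rw [← not_lt, ← lt_ordMap_iff_of_rankEquiv h hγ hα hj]
    exact lt_irrefl _
  · by_contra! hlt
    exact lt_irrefl _ ((lt_ordMap_iff_of_rankEquiv h hγ hα (hlt.trans hj)).1 hlt)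

/-- The truncation at `γ` loses nothing: `j x` and `k x` have only elements of rank below `j α = k α
< γ`. -/
theorem eq_of_rankEquiv (h : rankEquiv lam γ j k) (hγ : γ ≤ lam) (hα : α < γ)
    (hj : ordMap j α < γ) {x : VSet lam} (hx : x.1.rank < α) : j x = k x := by
  rw [VSet.eq_iff_forall_mem]
  have hxγ := hx.trans hα
  have hk := hj
  rw [← ordMap_eq_of_rankEquiv h hγ hα hj] at hk
  refine fun y => ⟨fun hy => ?_, fun hy => ?_⟩
  · refine (rankEquiv_iff.1 h x y hxγ ?_).1 hy
    refine (ZFSet.rank_lt_of_mem hy).trans ?_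
    rw [rank_emb]
    exact (ordMap_strictMono j hx).trans hj
  · refine (rankEquiv_iff.1 h x y hxγ ?_).2 hy
    refine (ZFSet.rank_lt_of_mem hy).trans ?_
    rw [rank_emb]
    exact (ordMap_strictMono k hx).trans hk

theorem rankEquiv_one_iff (hγ : γ ≤ lam) : rankEquiv lam γ j 1 ↔ Fixes j γ := by
  constructor
  · intro h α hα
    refine ordMap_eq_of_rankEquiv (Setoid.symm' _ h) hγ hα ?_ |>.trans ordMap_one
    rwa [ordMap_one]
  · intro h
    refine rankEquiv_iff.2 fun x y hx _ => ?_
    rw [h.apply x hx, (fixes_one (γ := γ)).apply x hx]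

/-- The set on the right to which `j` is applied depends on `k` only modulo `≡^β`. This is the
source of all compatibility of application with these relations. -/
theorem mem_act_apply_iff (hβ : β < lam) {x y : VSet lam} (hx : x.1.rank < ordMap j β)
    (hy : y.1.rank < ordMap j β) : y.1 ∈ ((j ◃ k) x).1 ↔
      (vpair x y).1 ∈ (j (relSet β hβ fun x y => y.1 ∈ (k x).1)).1 := by
  have := (preserve₃ j (Q := fun r f b => ∀ x y : VSet lam, (vpair x y).1 ∈ r.1 ↔
    x.1.rank < b.1.rank ∧ y.1.rank < b.1.rank ∧ ∃ z, (vpair x z).1 ∈ f.1 ∧ y.1 ∈ z.1)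
    (.all (.all (.iff .vpair_mem (.and .rank_lt (.and .rank_lt (.ex (.and .vpair_mem .mem)))))))
    (relSet β hβ fun x y => y.1 ∈ (k x).1) (graph k β hβ) (ordV β hβ)).2 ?_ x y
  · rw [this, rank_emb, rank_ordV]
    constructor
    · exact fun h => ⟨hx, hy, _, (vpair_mem_emb_graph j k).2 ⟨hx, rfl⟩, h⟩
    · rintro ⟨-, -, z, hz, hyz⟩
      rwa [((vpair_mem_emb_graph j k).1 hz).2] at hyz
  · intro x y
    rw [vpair_mem_relSet, rank_ordV]
    refine and_congr_right fun hx => and_congr_right fun hy => ⟨fun h => ?_, ?_⟩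
    · exact ⟨_, (vpair_mem_graph k).2 ⟨hx, rfl⟩, h⟩
    · rintro ⟨z, hz, hyz⟩
      rwa [((vpair_mem_graph k).1 hz).2] at hyz

theorem rankEquiv_act_right (h : rankEquiv lam β j k) (hβ : β < lam) (r : Emb lam) :
    rankEquiv lam (ordMap r β) (r ◃ j) (r ◃ k) := by
  refine rankEquiv_iff.2 fun x y hx hy => ?_
  rw [mem_act_apply_iff hβ hx hy, mem_act_apply_iff hβ hx hy,
    relSet_congr fun x y hx hy => rankEquiv_iff.1 h x y hx hy]

theorem isLDCongruence_rankEquiv (hγ : Order.IsSuccLimit γ) (hlt : γ ≤ lam) :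
    IsLDCongruence (rankEquiv lam γ) where
  act {j j' k k'} hj hk := by
    refine rankEquiv_iff.2 fun x y hx hy => ?_
    obtain ⟨β, hβ⟩ : ∃ β, β = max x.1.rank y.1.rank + 1 := ⟨_, rfl⟩
    have hβγ : β < γ := by
      rw [hβ]
      exact hγ.succ_lt (max_lt hx hy)
    have hx' : x.1.rank < β := hβ ▸ Order.lt_add_one_iff.2 (le_max_left _ _)
    have hy' : y.1.rank < β := hβ ▸ Order.lt_add_one_iff.2 (le_max_right _ _)
    have hβl := hβγ.trans_le hlt
    rw [mem_act_apply_iff hβl (hx'.trans_le (le_ordMap j β)) (hy'.trans_le (le_ordMap j β)),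
      mem_act_apply_iff hβl (hx'.trans_le (le_ordMap j' β)) (hy'.trans_le (le_ordMap j' β)),
      relSet_congr fun x y hx hy => rankEquiv_iff.1 hk x y (hx.trans hβγ) (hy.trans hβγ)]
    exact rankEquiv_iff.1 hj _ _ (rank_relSet_lt hβγ hγ) (ZFSet.mem_vonNeumann.1
      (pair_mem_vonNeumann hγ (ZFSet.mem_vonNeumann.2 hx) (ZFSet.mem_vonNeumann.2 hy)))
  mul {j j' k k'} hj hk := by
    refine rankEquiv_iff.2 fun x y hx hy => ?_
    have hβγ : y.1.rank + 1 < γ := hγ.succ_lt hy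
    have hβl := hβγ.trans_le hlt
    -- The set `k x` may have rank at least `γ`; whether `y ∈ j (k x)` depends only on its part in
    -- `V_(rank y + 1)`, as `rank y < j (rank y + 1)`.
    have key : ∀ j k : Emb lam, ∀ z : VSet lam, z.1 = (k x).1 ∩ V_ (y.1.rank + 1) →
        (y.1 ∈ ((j * k) x).1 ↔ y.1 ∈ (j z).1) := by
      intro j k z hz
      have := (preserve₃ j (Q := fun z w b => ∀ y : VSet lam, y.1 ∈ z.1 ↔
        y.1 ∈ w.1 ∧ y.1.rank < b.1.rank) (.all (.iff .mem (.and .mem .rank_lt)))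
        z (k x) (ordV _ hβl)).2 (fun y => by
          rw [hz, ZFSet.mem_inter, ZFSet.mem_vonNeumann, rank_ordV]) y
      rw [this, rank_emb, rank_ordV]
      exact (and_iff_left ((Order.lt_add_one_iff.2 le_rfl).trans_le (le_ordMap j _))).symm
    have hr : ((k x).1 ∩ V_ (y.1.rank + 1)).rank < γ := by
      refine lt_of_le_of_lt (ZFSet.rank_le_iff.2 fun z hz => ?_) hβγ
      exact ZFSet.mem_vonNeumann.1 (ZFSet.mem_inter.1 hz).2
    have he : (k x).1 ∩ V_ (y.1.rank + 1) = (k' x).1 ∩ V_ (y.1.rank + 1) :=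
      ZFSet.ext fun w => by
        rw [ZFSet.mem_inter, ZFSet.mem_inter, ZFSet.mem_vonNeumann]
        refine and_congr_left fun hw => ?_
        have := ZFSet.ext_iff.1 (hk x (ZFSet.mem_vonNeumann.2 hx)) w
        simpa [ZFSet.mem_vonNeumann, hw.trans hβγ] using this
    obtain ⟨z, hz⟩ : ∃ z : VSet lam, z.1 = (k x).1 ∩ V_ (y.1.rank + 1) :=
      ⟨⟨_, ZFSet.mem_vonNeumann.2 (hr.trans_le hlt)⟩, rfl⟩
    rw [key j k z hz, key j' k' z (hz.trans he)]
    exact rankEquiv_iff.1 hj _ _ (hz ▸ hr) hy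

end RankEquiv

/-! ### The quotients of `E_λ` -/

section Quotient

variable {lam : Ordinal.{u}} [hlam : Fact (Order.IsSuccLimit lam)] {γ : Ordinal.{u}}
  (h : IsLDCongruence (rankEquiv lam γ)) {j k r s : Emb lam}

theorem LDQuot.mk_eq_iff : LDQuot.mk h j = LDQuot.mk h k ↔ rankEquiv lam γ j k :=
  Quotient.eq

theorem LDQuot.mk_act : LDQuot.mk h j ◃ LDQuot.mk h k = LDQuot.mk h (j ◃ k) := rfl

theorem LDQuot.exists_mk (x : LDQuot (rankEquiv lam γ) h) : ∃ j, LDQuot.mk h j = x :=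
  Quotient.exists_rep x

/-- If `j` has critical point `c < γ`, then `j ◃ j` has the larger critical point `j c` and so fixes
`c`; thus `j ◃ j` and `j` are inequivalent. -/
theorem mk_mem_Li_iff (hγ : γ < lam) :
    LDQuot.mk h j ∈ Li (LDQuot (rankEquiv lam γ) h) ↔ Fixes j γ := by
  constructor
  · intro hj
    by_contra hf
    obtain ⟨c, hc, hcrit⟩ := exists_critAt hf
    have := (LDQuot.mk_eq_iff h).1 (hj (LDQuot.mk h j))
    have hfix := (hcrit.act j).fixes c hcrit.lt_ordMap
    have := ordMap_eq_of_rankEquiv this hγ.le hc (hfix.symm ▸ hc)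
    rw [hfix] at this
    exact hcrit.lt_ordMap.ne' this
  · intro hf x
    obtain ⟨k, rfl⟩ := LDQuot.exists_mk h x
    have : LDQuot.mk h j = LDQuot.mk h 1 := (LDQuot.mk_eq_iff h).2 ((rankEquiv_one_iff hγ.le).2 hf)
    rw [this, LDQuot.mk_act, LDMonoid.one_act]

theorem fib_mk (n : ℕ) : fib (LDQuot.mk h j) (LDQuot.mk h k) n = LDQuot.mk h (fib j k n) := by
  induction n using Nat.twoStepInduction with
  | zero => rfl
  | one => rfl
  | more n ih₁ ih₂ => rw [fib, ih₁, ih₂, LDQuot.mk_act, fib]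

theorem iterate_mk (n : ℕ) : (fun z => LDQuot.mk h r ◃ z)^[n] (LDQuot.mk h s) =
    LDQuot.mk h ((fun z => r ◃ z)^[n] s) := by
  induction n with
  | zero => rfl
  | succ n ih => rw [Function.iterate_succ_apply', ih, Function.iterate_succ_apply', LDQuot.mk_act]

/-- With `t n = fib j k n`, the law `x * y = (x ◃ y) * x` makes `t (n + 1) * t n` a constant `e`. If
`α < crit (t n)`, then `e α = t (n + 1) α < crit (t (n + 2))`. So some critical point exceeds each
iterate of `e` on its own critical point, and these iterates are cofinal. -/
theorem exists_fixes_fib (hγ : γ < lam) (j k : Emb lam) : ∃ n, Fixes (fib j k n) γ := by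
  by_contra! hn
  choose c _ hc using fun n => exists_critAt (hn n)
  obtain ⟨e, he⟩ : ∃ e, e = fib j k 1 * fib j k 0 := ⟨_, rfl⟩
  have hmul : ∀ n, fib j k (n + 1) * fib j k n = e := by
    intro n
    induction n with
    | zero => exact he.symm
    | succ n ih =>
      rw [← ih, LDMonoid.mul_eq_act_mul (fib j k (n + 1))]
      rfl
  have hcsucc : ∀ n, c (n + 2) = ordMap (fib j k (n + 1)) (c n) := fun n =>
    le_antisymm ((((hc n).act _).fixes_iff).1 (hc (n + 2)).fixes)
      ((hc (n + 2)).fixes_iff.1 ((hc n).act _).fixes)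
  have hstep : ∀ n α, α < c n → ordMap e α < c (n + 2) := fun n α hα => by
    rw [← hmul n, ordMap_mul, (hc n).fixes α hα, hcsucc]
    exact ordMap_strictMono _ hα
  have hecrit : CritAt e (min (c 0) (c 1)) := by
    rw [he]
    refine ⟨((hc 1).fixes.mono (min_le_right _ _)).mul ((hc 0).fixes.mono (min_le_left _ _)), ?_⟩
    rw [ordMap_mul]
    rcases le_total (c 0) (c 1) with hle | hle
    · rw [min_eq_left hle]
      exact (hc 0).lt_ordMap.trans_le (le_ordMap _ _)
    · rw [min_eq_right hle]
      exact (hc 1).lt_ordMap.trans_le ((ordMap_strictMono _).monotone (le_ordMap _ _))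
  -- If the first two critical points coincide, the third one, `j (c 0)`, is larger.
  have hbase : ∃ m, min (c 0) (c 1) < c m := by
    rcases lt_trichotomy (c 0) (c 1) with hlt | heq | hlt
    · exact ⟨1, by rwa [min_eq_left hlt.le]⟩
    · refine ⟨2, ?_⟩
      rw [hcsucc 0, heq, min_self]
      exact (hc 1).lt_ordMap
    · exact ⟨0, by rwa [min_eq_right hlt.le]⟩
  have hiter : ∀ i, ∃ m, (ordMap e)^[i] (min (c 0) (c 1)) < c m := by
    intro i
    induction i with
    | zero => exact hbase
    | succ i ih =>
      obtain ⟨m, hm⟩ := ih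
      rw [Function.iterate_succ_apply']
      exact ⟨m + 2, hstep m _ hm⟩
  obtain ⟨i, hi⟩ := hecrit.exists_lt_iterate hγ
  obtain ⟨m, hm⟩ := hiter i
  exact hn m ((hc m).fixes.mono (hi.trans hm).le)

theorem isPermutative_quot (hγ : γ < lam) : IsPermutative (LDQuot (rankEquiv lam γ) h) where
  leftIdeal x y hy := by
    obtain ⟨j, rfl⟩ := LDQuot.exists_mk h x
    obtain ⟨k, rfl⟩ := LDQuot.exists_mk h y
    rw [LDQuot.mk_act]
    rw [mk_mem_Li_iff h hγ] at hy ⊢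
    exact (hy.act j).mono (le_ordMap j γ)
  exists_fib_mem x y := by
    obtain ⟨j, rfl⟩ := LDQuot.exists_mk h x
    obtain ⟨k, rfl⟩ := LDQuot.exists_mk h y
    obtain ⟨n, hn⟩ := exists_fixes_fib hγ j k
    exact ⟨n, by rwa [fib_mk, mk_mem_Li_iff h hγ]⟩

theorem CritAt.iterate_act {c : Ordinal.{u}} (hs : CritAt s c) (r : Emb lam) (n : ℕ) :
    CritAt ((fun z => r ◃ z)^[n] s) ((ordMap r)^[n] c) := by
  induction n with
  | zero => exact hs
  | succ n ih =>
    rw [Function.iterate_succ_apply', Function.iterate_succ_apply']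
    exact ih.act r

theorem Fixes.iterate_act {c : Ordinal.{u}} (hs : Fixes s c) (r : Emb lam) (n : ℕ) :
    Fixes ((fun z => r ◃ z)^[n] s) ((ordMap r)^[n] c) := by
  induction n with
  | zero => exact hs
  | succ n ih =>
    rw [Function.iterate_succ_apply', Function.iterate_succ_apply']
    exact ih.act r

/-- Iterating `r ◃ ·` on `s` moves the critical point of `s` along `r`: it stays put if it is below
that of `r`, and otherwise exceeds `γ` eventually by `CritAt.exists_lt_iterate`. -/
theorem critLE_mk_iff (hγ : γ < lam) : CritLE (LDQuot.mk h r) (LDQuot.mk h s) ↔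
    ∀ β ≤ γ, Fixes r β → Fixes s β := by
  constructor
  · rintro ⟨n, hn⟩ β hβ hr
    by_contra hs
    obtain ⟨c, hc, hcrit⟩ := exists_critAt hs
    rw [iterate_mk, mk_mem_Li_iff h hγ, (hcrit.iterate_act r n).fixes_iff] at hn
    rw [Function.iterate_fixed (hr c hc)] at hn
    exact (hc.trans_le hβ).not_ge hn
  · intro hrs
    by_cases hr : Fixes r γ
    · exact ⟨0, (mk_mem_Li_iff h hγ).2 (hrs γ le_rfl hr)⟩
    · obtain ⟨c, hc, hcrit⟩ := exists_critAt hr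
      obtain ⟨n, hn⟩ := hcrit.exists_lt_iterate hγ
      refine ⟨n, ?_⟩
      rw [iterate_mk, mk_mem_Li_iff h hγ]
      exact ((hrs c hc.le hcrit.fixes).iterate_act r n).mono hn.le

end Quotient

/-! ### Critical points in an abstract permutative LD-system -/

section Permutative

variable {X : Type v} [Shelf X] [IsPermutative X] {x y : X}

theorem crit_eq_crit_iff : crit x = crit y ↔ CritLE x y ∧ CritLE y x := Quotient.eq

theorem crit_le_crit_iff : crit x ≤ crit y ↔ CritLE x y := Iff.rfl

theorem exists_crit_eq (α : Crit X) : ∃ x, crit x = α := Quotient.exists_rep α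

theorem isTop_crit (hx : x ∈ Li X) : IsTop (crit x) := fun β => by
  obtain ⟨y, rfl⟩ := exists_crit_eq β
  exact ⟨0, hx⟩

theorem crit_lt_crit (hx : x ∉ Li X) (hy : y ∈ Li X) : crit x < crit y := by
  refine lt_of_le_not_ge (isTop_crit hy _) fun h => ?_
  obtain ⟨n, hn⟩ := crit_le_crit_iff.1 h
  rw [Function.iterate_fixed (hy x)] at hn
  exact hx hn

end Permutative

/-- Transport of the structure of an LD-monoid along a bijection. -/
abbrev ldMonoidOfEquiv {X Y : Type v} [LDMonoid X] (e : X ≃ Y) : LDMonoid Y where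
  mul a b := e (e.symm a * e.symm b)
  one := e 1
  act a b := e (e.symm a ◃ e.symm b)
  mul_assoc a b c := by
    change e (e.symm (e _) * _) = e (_ * e.symm (e _))
    rw [e.symm_apply_apply, e.symm_apply_apply, mul_assoc]
  one_mul a := by
    change e (e.symm (e 1) * _) = a
    rw [e.symm_apply_apply, one_mul, e.apply_symm_apply]
  mul_one a := by
    change e (_ * e.symm (e 1)) = a
    rw [e.symm_apply_apply, mul_one, e.apply_symm_apply]
  self_distrib {a b c} := by
    simp only [e.symm_apply_apply]
    rw [Shelf.self_distrib]
  mul_act a b c := by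
    change e (e.symm (e _) ◃ _) = e (_ ◃ e.symm (e _))
    rw [e.symm_apply_apply, e.symm_apply_apply, LDMonoid.mul_act]
  act_mul a b c := by
    change e (_ ◃ e.symm (e _)) = e (e.symm (e _) * e.symm (e _))
    rw [e.symm_apply_apply, e.symm_apply_apply, e.symm_apply_apply, LDMonoid.act_mul]
  mul_eq_act_mul a b := by
    change e _ = e (e.symm (e _) * _)
    rw [e.symm_apply_apply, ← LDMonoid.mul_eq_act_mul]
  one_act a := by
    change e (e.symm (e 1) ◃ _) = a
    rw [e.symm_apply_apply, LDMonoid.one_act, e.apply_symm_apply]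
  act_one a := by
    change e (_ ◃ e.symm (e 1)) = e 1
    rw [e.symm_apply_apply, LDMonoid.act_one]

/-! ### The inverse system of the quotients -/

section System

variable {lam : Ordinal.{u}} [hlam : Fact (Order.IsSuccLimit lam)] {κ : ℕ → Ordinal.{u}}
  (hmono : Monotone κ) (hcong : ∀ n, IsLDCongruence (rankEquiv lam (κ n)))

theorem ordMap_pow (j : Emb lam) (n : ℕ) (α : Ordinal.{u}) :
    ordMap (j ^ n) α = (ordMap j)^[n] α := by
  induction n with
  | zero => exact ordMap_one
  | succ n ih => rw [pow_succ', ordMap_mul, ih, Function.iterate_succ_apply']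

theorem Fixes.pow {j : Emb lam} {γ : Ordinal.{u}} (h : Fixes j γ) (n : ℕ) : Fixes (j ^ n) γ := by
  induction n with
  | zero => exact fixes_one
  | succ n ih =>
    rw [pow_succ']
    exact h.mul ih

theorem exists_fixes_le_ordMap {α β : Ordinal.{u}} (hα : ∃ j : Emb lam, CritAt j α)
    (hβ : β < lam) : ∃ r : Emb lam, Fixes r α ∧ β ≤ ordMap r α := by
  obtain ⟨j, hj⟩ := hα
  obtain ⟨n, hn⟩ := hj.exists_lt_iterate hβ
  exact ⟨j ^ n, hj.fixes.pow n, by rw [ordMap_pow]; exact hn.le⟩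

theorem exists_lt_of_lt_lam (hcof : ∀ α < lam, ∃ n, α ≤ κ n) {α : Ordinal.{u}} (h : α < lam) :
    ∃ n, α < κ n := by
  obtain ⟨n, hn⟩ := hcof _ (add_one_lt_lam h)
  exact ⟨n, (Order.lt_add_one_iff.2 le_rfl).trans_le hn⟩

/-- Every class is represented by an embedding with a critical point at most `κ n`. -/
theorem exists_critAt_mk_eq {n : ℕ} (hlt : κ n < lam) (hcrit : ∃ j : Emb lam, CritAt j (κ n))
    (k : Emb lam) : ∃ (r : Emb lam) (c : Ordinal.{u}), CritAt r c ∧ c ≤ κ n ∧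
      LDQuot.mk (hcong n) r = LDQuot.mk (hcong n) k := by
  by_cases hk : Fixes k (κ n)
  -- The class of the identity also contains an embedding with critical point exactly `κ n`.
  · obtain ⟨j, hj⟩ := hcrit
    exact ⟨j, _, hj, le_rfl, (LDQuot.mk_eq_iff _).2 (Setoid.trans'
      _ ((rankEquiv_one_iff hlt.le).2 hj.fixes) (Setoid.symm' _ ((rankEquiv_one_iff hlt.le).2 hk)))⟩
  · obtain ⟨c, hc, hc'⟩ := exists_critAt hk
    exact ⟨k, c, hc', hc.le, rfl⟩

theorem transition_mk (n i : ℕ) (j : Emb lam) :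
    transition (embTransition hmono hcong) n i (LDQuot.mk (hcong (n + i)) j) =
      LDQuot.mk (hcong n) j := by
  induction i with
  | zero => rfl
  | succ i ih => exact ih

theorem eq_of_forall_mk_eq (hcof : ∀ α < lam, ∃ n, α ≤ κ n) {j k : Emb lam}
    (h : ∀ n, LDQuot.mk (hcong n) j = LDQuot.mk (hcong n) k) : j = k := by
  ext x : 1
  rw [VSet.eq_iff_forall_mem]
  intro y
  obtain ⟨n, hn⟩ := exists_lt_of_lt_lam hcof (max_lt (rank_lt x) (rank_lt y))
  exact rankEquiv_iff.1 ((LDQuot.mk_eq_iff _).1 (h n)) x y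
    ((le_max_left _ _).trans_lt hn) ((le_max_right _ _).trans_lt hn)

theorem isOpen_setOf_mk_mem (hlt : ∀ n, κ n < lam) (n : ℕ) (s : Set (EmbQuot hcong n)) :
    IsOpen {j | LDQuot.mk (hcong n) j ∈ s} := by
  intro j hj
  refine ⟨κ n, .inl (hlt n), fun k hk => ?_⟩
  have : LDQuot.mk (hcong n) k = LDQuot.mk (hcong n) j :=
    (LDQuot.mk_eq_iff _).2 fun x hx => by rw [hk x hx]
  change LDQuot.mk (hcong n) k ∈ s
  rw [this]
  exact hj

/-- If `j γ < κ n`, then the class of `j` modulo `≡^(κ n)` determines `j` on `V_γ`. -/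
theorem exists_forall_mk_eq_mem {U : Set (Emb lam)} (hcof : ∀ α < lam, ∃ n, α ≤ κ n)
    (hlt : ∀ n, κ n < lam) (hU : IsOpen U)
    {j : Emb lam} (hj : j ∈ U) :
    ∃ n, ∀ k, LDQuot.mk (hcong n) k = LDQuot.mk (hcong n) j → k ∈ U := by
  obtain ⟨γ, hγ, h⟩ := hU j hj
  have hγ' : γ < lam := hγ.elim id fun e => e ▸ hlam.out.bot_lt
  obtain ⟨n, hn⟩ := exists_lt_of_lt_lam hcof (ordMap_lt j hγ')
  refine ⟨n, fun k hk => h k fun x hx => ?_⟩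
  exact eq_of_rankEquiv (Setoid.symm' _ ((LDQuot.mk_eq_iff _).1 hk)) (hlt n).le
    ((le_ordMap j γ).trans_lt hn) hn (ZFSet.mem_vonNeumann.1 hx)

variable [hperm : ∀ n, IsPermutative (EmbQuot hcong n)]

theorem isVast_embTransition (hcof : ∀ α < lam, ∃ n, α ≤ κ n)
    (hcrit : ∀ n, ∃ j : Emb lam, CritAt j (κ n)) (hlt : ∀ n, κ n < lam) :
    IsVast (embTransition hmono hcong) where
  ker_eq n := by
    have hle := hmono (Nat.le_succ n)
    -- As `r (κ n) ≥ κ (n + 1)`, application of `r` lifts `≡^(κ n)` to `≡^(κ (n + 1))` and makes `r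
    -- ◃ r` a left identity.
    obtain ⟨r, hr, hr'⟩ := exists_fixes_le_ordMap (hcrit n) (hlt (n + 1))
    refine ⟨crit (LDQuot.mk (hcong (n + 1)) r), fun x y => ?_⟩
    obtain ⟨j, rfl⟩ := LDQuot.exists_mk _ x
    obtain ⟨k, rfl⟩ := LDQuot.exists_mk _ y
    change LDQuot.mk (hcong n) j = LDQuot.mk (hcong n) k ↔ _
    rw [LDQuot.mk_eq_iff]
    constructor
    · intro hjk
      refine ⟨LDQuot.mk _ r, ?_, rfl, ?_⟩
      · rw [LDQuot.mk_act, mk_mem_Li_iff _ (hlt _)]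
        exact (hr.act r).mono hr'
      · rw [LDQuot.mk_act, LDQuot.mk_act, LDQuot.mk_eq_iff]
        exact rankEquiv_mono hr' (rankEquiv_act_right hjk (hlt n) r)
    · rintro ⟨s, -, hs, hjk⟩
      obtain ⟨s, rfl⟩ := LDQuot.exists_mk _ s
      have hf : Fixes s (κ n) :=
        (critLE_mk_iff _ (hlt _)).1 (crit_eq_crit_iff.1 hs).2 _ hle hr
      rw [LDQuot.mk_act, LDQuot.mk_act, LDQuot.mk_eq_iff] at hjk
      -- Any other witness `s` also fixes the ordinals below `κ n`, so it acts as the identity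
      -- modulo `≡^(κ n)`.
      have key : ∀ j, rankEquiv lam (κ n) (s ◃ j) j := fun j => by
        have := (hcong n).act ((rankEquiv_one_iff (hlt n).le).2 hf)
          (Setoid.refl' (rankEquiv lam (κ n)) j)
        rwa [LDMonoid.one_act] at this
      exact Setoid.trans' _ (Setoid.symm' _ (key j))
        (Setoid.trans' _ (rankEquiv_mono hle hjk) (key k))
  exists_lift n x y := by
    obtain ⟨j, rfl⟩ := LDQuot.exists_mk _ x
    obtain ⟨k, rfl⟩ := LDQuot.exists_mk _ y
    -- A representative with a critical point `c` is needed, lest `k` be the identity; then `crit (j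
    -- ◃ r) = j c` is below a later `κ`.
    obtain ⟨r, c, hr, -, e⟩ := exists_critAt_mk_eq hcong (hlt n) (hcrit n) k
    obtain ⟨m, hm⟩ := exists_lt_of_lt_lam hcof (ordMap_lt j hr.lt)
    refine ⟨m, LDQuot.mk _ j, LDQuot.mk _ r, transition_mk hmono hcong n m j,
      (transition_mk hmono hcong n m r).trans e, ?_⟩
    rw [LDQuot.mk_act, mk_mem_Li_iff _ (hlt _), (hr.act j).fixes_iff, not_le]
    exact hm.trans_le (hmono (Nat.le_add_left m n))

/-- The identification of critical points keeps the true ordinal `c`. The case `c = κ n` covers the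
greatest element of level `n`, so a representative of exactly that critical point is required there.
-/
theorem isLeast_crit_mk (hlt : ∀ n, κ n < lam) {n : ℕ} {r : Emb lam} {c : Ordinal.{u}}
    (hr : CritAt r c) (hc : c ≤ κ n) :
    IsLeast {γ | ∃ x : EmbQuot hcong (n + 1), crit ((embTransition hmono hcong n).toFun x) =
      crit (LDQuot.mk (hcong n) r) ∧ crit x = γ} (crit (LDQuot.mk (hcong (n + 1)) r)) := by
  refine ⟨⟨_, rfl, rfl⟩, ?_⟩
  rintro _ ⟨x, hx, rfl⟩
  obtain ⟨s, rfl⟩ := LDQuot.exists_mk _ x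
  change crit (LDQuot.mk (hcong n) s) = _ at hx
  rw [crit_le_crit_iff, critLE_mk_iff _ (hlt _)]
  intro β _ hβ
  exact ((critLE_mk_iff _ (hlt _)).1 (crit_eq_crit_iff.1 hx).2 c hc hr.fixes).mono
    (hr.fixes_iff.1 hβ)

theorem incl_crit_mk_add (hlt : ∀ n, κ n < lam) {n : ℕ} {r : Emb lam} {c : Ordinal.{u}}
    (hr : CritAt r c) (hc : c ≤ κ n) (i : ℕ) :
    CritUnion.incl (embTransition hmono hcong) n (crit (LDQuot.mk (hcong n) r)) =
      CritUnion.incl (embTransition hmono hcong) (n + i) (crit (LDQuot.mk (hcong (n + i)) r)) := by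
  induction i with
  | zero => rfl
  | succ i ih =>
    rw [ih]
    exact Quot.sound (.step _ _ _ (isLeast_crit_mk hmono hcong hlt hr
      (hc.trans (hmono (Nat.le_add_right n i)))))

/-- The ordinals that are at most the critical point, as an element of `crit[E_λ / ≡^(κ n)]`. -/
def belowCrit (p : Σ n, Crit (EmbQuot hcong n)) : Set Ordinal.{u} :=
  {β | β ≤ κ p.1 ∧ ∃ r, crit (LDQuot.mk (hcong p.1) r) = p.2 ∧ Fixes r β}

theorem mem_belowCrit_iff (hlt : ∀ n, κ n < lam) {n : ℕ} {r : Emb lam} {β : Ordinal.{u}} :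
    β ∈ belowCrit hcong ⟨n, crit (LDQuot.mk (hcong n) r)⟩ ↔ β ≤ κ n ∧ Fixes r β := by
  refine and_congr_right fun hβ => ⟨?_, fun h => ⟨r, rfl, h⟩⟩
  rintro ⟨s, hs, hsβ⟩
  exact (critLE_mk_iff _ (hlt _)).1 (crit_eq_crit_iff.1 hs).1 β hβ hsβ

/-- `belowCrit` is an invariant of the identifications, so it descends to `CritUnion`; equalities
there can be exploited without analysing the generated equivalence relation. -/
theorem belowCrit_eq_of_critIdent (hcrit : ∀ n, ∃ j : Emb lam, CritAt j (κ n))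
    (hlt : ∀ n, κ n < lam) {p q : Σ n, Crit (EmbQuot hcong n)}
    (h : CritIdent (embTransition hmono hcong) p q) : belowCrit hcong p = belowCrit hcong q := by
  obtain ⟨n, α, β, h⟩ := h
  obtain ⟨x, rfl⟩ := exists_crit_eq α
  obtain ⟨k, rfl⟩ := LDQuot.exists_mk _ x
  obtain ⟨r, c, hr, hc, e⟩ := exists_critAt_mk_eq hcong (hlt n) (hcrit n) k
  rw [← e] at h ⊢
  rw [h.unique (isLeast_crit_mk hmono hcong hlt hr hc)]
  ext δ
  rw [mem_belowCrit_iff hcong hlt, mem_belowCrit_iff hcong hlt, hr.fixes_iff]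
  exact ⟨fun h => ⟨h.2.trans (hc.trans (hmono (Nat.le_succ n))), h.2⟩,
    fun h => ⟨h.2.trans hc, h.2⟩⟩

theorem belowCrit_eq_of_incl_eq (hcrit : ∀ n, ∃ j : Emb lam, CritAt j (κ n))
    (hlt : ∀ n, κ n < lam) {n m : ℕ} {α : Crit (EmbQuot hcong n)}
    {β : Crit (EmbQuot hcong m)} (h : CritUnion.incl (embTransition hmono hcong) n α =
      CritUnion.incl (embTransition hmono hcong) m β) :
    belowCrit hcong ⟨n, α⟩ = belowCrit hcong ⟨m, β⟩ :=
  congrArg (Quot.lift (belowCrit hcong) fun _ _ =>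
    belowCrit_eq_of_critIdent hmono hcong hcrit hlt) h

/-! ### The map `Γ` -/

theorem mk_mem_EE (hcof : ∀ α < lam, ∃ n, α ≤ κ n)
    (hcrit : ∀ n, ∃ j : Emb lam, CritAt j (κ n)) (hlt : ∀ n, κ n < lam) (j : Emb lam) :
    (fun n => LDQuot.mk (hcong n) j) ∈ EE (embTransition hmono hcong) := by
  refine ⟨fun n => rfl, ?_⟩
  rintro ⟨n, α⟩
  obtain ⟨x, rfl⟩ := exists_crit_eq α
  obtain ⟨k, rfl⟩ := LDQuot.exists_mk _ x
  obtain ⟨r, c, hr, hc, e⟩ := exists_critAt_mk_eq hcong (hlt n) (hcrit n) k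
  obtain ⟨m, hm⟩ := exists_lt_of_lt_lam hcof (ordMap_lt j hr.lt)
  have hone : LDQuot.mk (hcong (n + m)) 1 ∈ Li (EmbQuot hcong (n + m)) :=
    (mk_mem_Li_iff _ (hlt _)).2 fixes_one
  refine ⟨n + m, crit (LDQuot.mk _ r), ?_, crit (LDQuot.mk _ 1), isTop_crit hone, ?_⟩
  · rw [← incl_crit_mk_add hmono hcong hlt hr hc, e]
    rfl
  · change crit (LDQuot.mk _ (j ◃ r)) < _
    refine crit_lt_crit ?_ hone
    rw [mk_mem_Li_iff _ (hlt _), (hr.act j).fixes_iff, not_le]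
    exact hm.trans_le (hmono (Nat.le_add_left m n))

/-- The thread condition is used at the critical point `κ n`. It gives an `s` that fixes all
ordinals below `κ n` while `A m ◃ s` is not a left identity modulo `≡^(κ m)`; were `A m (κ n) ≥ κ
m`, it would be one. -/
theorem exists_ordMap_lt_of_mem_EE (hcrit : ∀ n, ∃ j : Emb lam, CritAt j (κ n))
    (hlt : ∀ n, κ n < lam) {a : ∀ n, EmbQuot hcong n}
    (ha : a ∈ EE (embTransition hmono hcong)) {A : ℕ → Emb lam}
    (hA : ∀ n, LDQuot.mk (hcong n) (A n) = a n) (n : ℕ) : ∃ m, ordMap (A m) (κ n) < κ m := by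
  obtain ⟨j, hj⟩ := hcrit n
  obtain ⟨m, β, hβ, μ, hμ, hlt'⟩ := ha.2
    (CritUnion.incl _ n (crit (LDQuot.mk (hcong n) j)))
  obtain ⟨x, rfl⟩ := exists_crit_eq β
  obtain ⟨s, rfl⟩ := LDQuot.exists_mk _ x
  have hs : κ n ∈ belowCrit hcong ⟨m, crit (LDQuot.mk (hcong m) s)⟩ := by
    rw [belowCrit_eq_of_incl_eq hmono hcong hcrit hlt hβ, mem_belowCrit_iff hcong hlt]
    exact ⟨le_rfl, hj.fixes⟩
  have hfix := ((mem_belowCrit_iff hcong hlt).1 hs).2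
  refine ⟨m, ?_⟩
  rw [← hA m] at hlt'
  have hnot : ¬ Fixes (A m ◃ s) (κ m) := by
    rw [← mk_mem_Li_iff (hcong m) (hlt m)]
    intro hmem
    exact (isTop_crit hmem μ).not_gt hlt'
  by_contra! hle
  exact hnot ((hfix.act (A m)).mono hle)

theorem exists_mk_eq_of_mem_EE (hcof : ∀ α < lam, ∃ n, α ≤ κ n)
    (hcrit : ∀ n, ∃ j : Emb lam, CritAt j (κ n)) (hlt : ∀ n, κ n < lam) {a : ∀ n, EmbQuot hcong n}
    (ha : a ∈ EE (embTransition hmono hcong)) : ∃ j, (fun n => LDQuot.mk (hcong n) j) = a := by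
  choose A hA using fun n => LDQuot.exists_mk (hcong n) (a n)
  have hthread : ∀ n m, n ≤ m → rankEquiv lam (κ n) (A m) (A n) := by
    intro n m hnm
    induction m, hnm using Nat.le_induction with
    | base => exact Setoid.refl' _ _
    | succ m hnm ih =>
      refine Setoid.trans' _ (rankEquiv_mono (hmono hnm) ?_) ih
      rw [← LDQuot.mk_eq_iff (hcong m), hA m, ← ha.1 m, ← hA (m + 1)]
      rfl
  -- For `x ∈ V_(κ n)` and `A m (κ n) < κ m`, all later representatives agree with `A m` at `x`.
  have hconst : ∀ x : VSet lam, ∃ y, ∃ m, ∀ i ≥ m, A i x = y := by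
    intro x
    obtain ⟨n, hn⟩ := exists_lt_of_lt_lam hcof (rank_lt x)
    obtain ⟨m, hm⟩ := exists_ordMap_lt_of_mem_EE hmono hcong hcrit hlt ha hA n
    exact ⟨A m x, m, fun i hi => (eq_of_rankEquiv (Setoid.symm' _ (hthread m i hi)) (hlt m).le
      ((le_ordMap _ _).trans_lt hm) hm hn).symm⟩
  choose l N hl using hconst
  let j : Emb lam := ⟨l, fun n φ x => by
    -- On a finite tuple the pointwise limit coincides with a single `A i`, so it inherits
    -- elementarity.
    have : l ∘ x = A (Finset.univ.sup fun i => N (x i)) ∘ x := funext fun i =>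
      (hl (x i) _ (Finset.le_sup (f := fun i => N (x i)) (Finset.mem_univ i))).symm
    rw [this]
    exact (A _).map_formula φ x⟩
  refine ⟨j, funext fun n => ?_⟩
  rw [← hA n, LDQuot.mk_eq_iff]
  intro x hx
  rw [show j x = A (max n (N x)) x from (hl x _ (le_max_right _ _)).symm]
  exact hthread n _ (le_max_left _ _) x hx

/-- The bijection `j ↦ ([j]_(κ n))_n`. -/
noncomputable def equivEE (hcof : ∀ α < lam, ∃ n, α ≤ κ n)
    (hcrit : ∀ n, ∃ j : Emb lam, CritAt j (κ n)) (hlt : ∀ n, κ n < lam) :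
    Emb lam ≃ EE (embTransition hmono hcong) :=
  Equiv.ofBijective (fun j => ⟨_, mk_mem_EE hmono hcong hcof hcrit hlt j⟩) <| by
    refine ⟨fun j k e => ?_, fun a => ?_⟩
    · exact eq_of_forall_mk_eq hcong hcof fun n => congrFun (congrArg Subtype.val e) n
    · obtain ⟨j, hj⟩ := exists_mk_eq_of_mem_EE hmono hcong hcof hcrit hlt a.2
      exact ⟨j, Subtype.ext hj⟩

/-- The homeomorphism `j ↦ ([j]_(κ n))_n`. -/
noncomputable def homeomorphEE (hcof : ∀ α < lam, ∃ n, α ≤ κ n)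
    (hcrit : ∀ n, ∃ j : Emb lam, CritAt j (κ n)) (hlt : ∀ n, κ n < lam) :
    Emb lam ≃ₜ EE (embTransition hmono hcong) where
  toEquiv := equivEE hmono hcong hcof hcrit hlt
  continuous_toFun := by
    let _ : ∀ n, TopologicalSpace (EmbQuot hcong n) := fun _ => ⊥
    refine continuous_induced_rng.2 (continuous_pi fun n => ?_)
    exact ⟨fun s _ => isOpen_setOf_mk_mem hcong hlt n s⟩
  continuous_invFun := by
    let _ : ∀ n, TopologicalSpace (EmbQuot hcong n) := fun _ => ⊥
    have : ∀ n, DiscreteTopology (EmbQuot hcong n) := fun _ => ⟨rfl⟩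
    have hproj : ∀ n, Continuous fun a : EE (embTransition hmono hcong) => a.1 n := fun n =>
      (continuous_apply n).comp continuous_induced_dom
    refine ⟨fun U hU => isOpen_iff_forall_mem_open.2 fun a ha => ?_⟩
    obtain ⟨j, rfl⟩ := (equivEE hmono hcong hcof hcrit hlt).surjective a
    have hj : j ∈ U := by
      have : (equivEE hmono hcong hcof hcrit hlt).symm
        (equivEE hmono hcong hcof hcrit hlt j) ∈ U := ha
      rwa [Equiv.symm_apply_apply] at this
    obtain ⟨n, hn⟩ := exists_forall_mk_eq_mem hcong hcof hlt hU hj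
    refine ⟨{b | b.1 n = LDQuot.mk (hcong n) j}, fun b hb => ?_,
      (hproj n).isOpen_preimage _ (isOpen_discrete {LDQuot.mk (hcong n) j}), rfl⟩
    obtain ⟨k, rfl⟩ := (equivEE hmono hcong hcof hcrit hlt).surjective b
    change (equivEE hmono hcong hcof hcrit hlt).symm _ ∈ U
    rw [Equiv.symm_apply_apply]
    exact hn k hb

end System

end RankIntoRank

open RankIntoRank
theorem mainTheorem10 (lam : Ordinal.{u}) (κ : ℕ → Ordinal.{u})
    (hmono : Monotone κ)
    (hcof : ∀ α < lam, ∃ n, α ≤ κ n)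
    (hcrit : ∀ n, ∃ j : Emb lam, IsCrit j (κ n)) :
    -- `E_λ` is an LD-monoid under application, composition and the identity
    ∃ _ : LDMonoid (Emb lam),
      (∀ j k : Emb lam, IsApplication j k (j ◃ k)) ∧
      (∀ (j k : Emb lam) (x : VSet lam), (j * k) x = j (k x)) ∧
      (∀ x : VSet lam, (1 : Emb lam) x = x) ∧
      -- the quotients `E_λ / ≡^(κ n)` form a vast system of permutative LD-systems
      ∃ (hcong : ∀ n, IsLDCongruence (rankEquiv lam (κ n)))
        (_ : ∀ n, IsPermutative (EmbQuot hcong n)),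
        IsVast (embTransition hmono hcong) ∧
        -- `EE` is an LD-monoid under the componentwise operations
        ∃ _ : LDMonoid (EE (embTransition hmono hcong)),
          (∀ (a b : EE (embTransition hmono hcong)) (n : ℕ), (a ◃ b).1 n = a.1 n ◃ b.1 n) ∧
          (∀ (a b : EE (embTransition hmono hcong)) (n : ℕ), (a * b).1 n = a.1 n * b.1 n) ∧
          (∀ n, (1 : EE (embTransition hmono hcong)).1 n = 1) ∧
          -- and `j ↦ ([j]_(κ n))_n` is a homeomorphism and an isomorphism of LD-monoids
          ∃ Γ : Emb lam ≃ₜ EE (embTransition hmono hcong),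
            (∀ (j : Emb lam) (n : ℕ), (Γ j).1 n = LDQuot.mk (hcong n) j) ∧
            (∀ j k : Emb lam, Γ (j ◃ k) = Γ j ◃ Γ k) ∧
            (∀ j k : Emb lam, Γ (j * k) = Γ j * Γ k) ∧
            Γ 1 = 1 := by
  have : Fact (Order.IsSuccLimit lam) := ⟨isSuccLimit_of_isCrit hcof hcrit⟩
  let _ := embLDMonoid lam
  have hcrit' : ∀ n, ∃ j : Emb lam, CritAt j (κ n) := fun n => (hcrit n).imp fun _ h => h.critAt
  have hlt : ∀ n, κ n < lam := fun n => (hcrit n).choose_spec.lt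
  have hcong : ∀ n, IsLDCongruence (rankEquiv lam (κ n)) := fun n =>
    isLDCongruence_rankEquiv (hcrit' n).choose_spec.isSuccLimit (hlt n).le
  have hperm : ∀ n, IsPermutative (EmbQuot hcong n) := fun n =>
    isPermutative_quot (hcong n) (hlt n)
  let Γ := homeomorphEE hmono hcong hcof hcrit' hlt
  have hΓ : ∀ (j : Emb lam) (n : ℕ), (Γ j).1 n = LDQuot.mk (hcong n) j := fun _ _ => rfl
  -- The operations on `EE` are transported along `Γ`; they are componentwise since `Γ` is onto and
  -- taking classes is a homomorphism.
  refine ⟨embLDMonoid lam, fun j k => isApplication_appl j k, fun _ _ _ => rfl, fun _ => rfl, hcong,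
    hperm, isVast_embTransition hmono hcong hcof hcrit' hlt, ldMonoidOfEquiv Γ.toEquiv, ?_, ?_,
    fun _ => rfl, Γ, hΓ, ?_, ?_, rfl⟩
  · intro a b n
    obtain ⟨j, rfl⟩ := Γ.surjective a
    obtain ⟨k, rfl⟩ := Γ.surjective b
    change (Γ (Γ.symm (Γ j) ◃ Γ.symm (Γ k))).1 n = _
    rw [Γ.symm_apply_apply, Γ.symm_apply_apply]
    rfl
  · intro a b n
    obtain ⟨j, rfl⟩ := Γ.surjective a
    obtain ⟨k, rfl⟩ := Γ.surjective b
    change (Γ (Γ.symm (Γ j) * Γ.symm (Γ k))).1 n = _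
    rw [Γ.symm_apply_apply, Γ.symm_apply_apply]
    rfl
  · intro j k
    change _ = Γ (Γ.symm (Γ j) ◃ Γ.symm (Γ k))
    rw [Γ.symm_apply_apply, Γ.symm_apply_apply]
  · intro j k
    change _ = Γ (Γ.symm (Γ j) * Γ.symm (Γ k))
    rw [Γ.symm_apply_apply, Γ.symm_apply_apply]
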